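/- Let $d\ge 1$ and let $B_d=\{z\in\mathbb C^d:|z|<1\}$ be the open unit ball, where $|z|$ is the Euclidean norm. Let $\sigma_d$ be the normalized Lebesgue measure on the unit sphere $\partial B_d$. For a holomorphic function $f:B_d\to\mathbb C$ and $0\le r<1$ put $$M_p(f,r)=\Big(\int_{\partial B_d}|f(r\zeta)|^p\,d\sigma_d(\zeta)\Big)^{1/p}\quad(0<p<\infty),\qquad M_\infty(f,r)=\sup\{|f(z)|:|z|=r\}.$$ A weight is a continuous non-decreasing function $w:[0,1)\to(0,+\infty)$; it is log-convex if $\log w(r)$ is a convex function of $\log r$ for $0<r<1$. Functions $u,v:[0,1)\to(0,+\infty)$ are equivalent, $u\asymp v$, if there are constants $C_1,C_2>0$ such that $C_1u(r)\le v(r)\le C_2u(r)$ for all $0\le r<1$. Let $0<p\le\infty$ and let $w:[0,1)\to(0,+\infty)$ be a weight. Then the following are equivalent: (i) $w$ is equivalent to a log-convex weight on $[0,1)$; (ii) there exists a holomorphic function $f$ on $B_d$ such that $M_p(f,r)\asymp w(r)$, $0\le r<1$ (in particular $M_p(f,r)>0$ for all $0\le r<1$). -/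

import Mathlib

open MeasureTheory Set Metric
open scoped ENNReal

/-- The unit sphere of `ℂ^d` with its Hermitian (Euclidean) norm. -/
abbrev UnitSphere (d : ℕ) : Type := sphere (0 : EuclideanSpace ℂ (Fin d)) 1

/-- The normalized Lebesgue (surface) measure on the unit sphere of `ℂ^d`. -/
noncomputable def sphereMeasure (d : ℕ) : Measure (UnitSphere d) :=
  ((volume : Measure (EuclideanSpace ℂ (Fin d))).toSphere univ)⁻¹ •
    (volume : Measure (EuclideanSpace ℂ (Fin d))).toSphere

/-- The holomorphic functions on the open unit ball of `ℂ^d`; values off the ball are irrelevant. -/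
def IsHolomorphicOnBall (d : ℕ) (f : EuclideanSpace ℂ (Fin d) → ℂ) : Prop :=
  DifferentiableOn ℂ f (ball 0 1)

/-- The integral mean `M_p(f, r)`, for `0 < p ≤ ∞` and `0 ≤ r < 1`. -/
noncomputable def integralMean {d : ℕ} (p : ℝ≥0∞) (f : EuclideanSpace ℂ (Fin d) → ℂ)
    (r : ℝ) : ℝ :=
  if p = ∞ then
    sSup ((fun z => ‖f z‖) '' {z : EuclideanSpace ℂ (Fin d) | ‖z‖ = r})
  else
    (∫ ζ : UnitSphere d,
      ‖f (r • (ζ : EuclideanSpace ℂ (Fin d)))‖ ^ p.toReal ∂(sphereMeasure d)) ^ (1 / p.toReal)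

/-- A weight on `[0, 1)`: positive, continuous and non-decreasing. -/
structure IsWeight (w : ℝ → ℝ) : Prop where
  pos : ∀ r ∈ Ico (0 : ℝ) 1, 0 < w r
  continuousOn : ContinuousOn w (Ico 0 1)
  monotoneOn : MonotoneOn w (Ico 0 1)

/-- A log-convex weight: `log w(r)` is a convex function of `t = log r`, `0 < r < 1`. -/
structure IsLogConvexWeight (w : ℝ → ℝ) : Prop extends IsWeight w where
  logConvex : ConvexOn ℝ (Iio (0 : ℝ)) (fun t => Real.log (w (Real.exp t)))

/-- Equivalence `u ≍ v` on `X` of functions that are strictly positive on `X`. -/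
def EquivalentOn {α : Type*} (X : Set α) (u v : α → ℝ) : Prop :=
  (∀ x ∈ X, 0 < u x ∧ 0 < v x) ∧
    ∃ C₁ C₂ : ℝ, 0 < C₁ ∧ 0 < C₂ ∧ ∀ x ∈ X, C₁ * u x ≤ v x ∧ v x ≤ C₂ * u x

/-! ### Monomial comparison and log-concave sequences -/

/-! (ii) ⇒ (i): the mean itself is a log-convex weight (Hardy's theorem,
`convexOn_log_integralMean`). Apply the sub-mean value property to `|exp (a z / P) f (exp z • ζ)| ^
P` on a disc in the left half-plane. Integrating over `ζ`, or taking the maximizing `ζ`, removes the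
imaginary part of `z` by rotation invariance, so every exponential tilt of the mean, in the variable
`s = log r`, satisfies a one-dimensional averaging inequality. The maximum principle for all tilts
is convexity of the logarithm.

(i) ⇒ (ii): constants handle bounded weights. For unbounded `v`, let `b n r ^ n` be the largest
minorants of this form. A supporting line of `log v`, with slope rounded up to an integer, shows
that `v` is comparable to the maximal term `max_n b n r ^ n`. The sequence `b` is log-concave, so
term `n` is maximal between consecutive crossing radii. A greedy choice of separated indices
(`exists_lacunary`) keeps so few terms that at each radius all but two consecutive ones decay
geometrically, and so many that these two still control `v`.

The function is the corresponding lacunary series in one coordinate, each monomial normalized in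
mean. The two dominant terms cannot cancel: a rotation reverses their relative sign without changing
the mean (`le_two_mul_add`), and the other terms are too small to matter (`tsum_comparable`).
Quasi-means treat all `0 < p ≤ ∞` at once. -/

lemma monomial_le_of_le_of_le {A B x y : ℝ} {i j : ℕ} (hB : 0 ≤ B) (hx : 0 < x) (hxy : x ≤ y)
    (hij : i ≤ j) (h : A * x ^ i ≤ B * x ^ j) : A * y ^ i ≤ B * y ^ j := by
  have h1 : 1 ≤ y / x := (one_le_div hx).2 hxy
  have e : ∀ n : ℕ, y ^ n = x ^ n * (y / x) ^ n := fun n => by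
    rw [div_pow, mul_div_cancel₀ _ (pow_pos hx n).ne']
  calc A * y ^ i = A * x ^ i * (y / x) ^ i := by rw [e i]; ring
    _ ≤ B * x ^ j * (y / x) ^ i := by gcongr
    _ ≤ B * x ^ j * (y / x) ^ j := by
        have := pow_le_pow_right₀ h1 hij
        gcongr
    _ = B * y ^ j := by rw [e j]; ring

lemma monomial_le_of_ge_of_le {A B x y : ℝ} {i j : ℕ} (hB : 0 ≤ B) (hy : 0 ≤ y) (hx : 0 < x)
    (hxy : y ≤ x) (hij : i ≤ j) (h : B * x ^ j ≤ A * x ^ i) : B * y ^ j ≤ A * y ^ i := by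
  have h0 : 0 ≤ y / x := by positivity
  have h1 : y / x ≤ 1 := (div_le_one hx).2 hxy
  have e : ∀ n : ℕ, y ^ n = x ^ n * (y / x) ^ n := fun n => by
    rw [div_pow, mul_div_cancel₀ _ (pow_pos hx n).ne']
  calc B * y ^ j = B * x ^ j * (y / x) ^ j := by rw [e j]; ring
    _ ≤ B * x ^ j * (y / x) ^ i := by
        have := pow_le_pow_of_le_one h0 h1 hij
        gcongr
    _ ≤ A * x ^ i * (y / x) ^ i := by gcongr
    _ = A * y ^ i := by rw [e i]; ring

/-- The radius at which the terms `b (n - 1) r ^ (n - 1)` and `b n r ^ n` coincide. -/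
noncomputable def crossingRadius (b : ℕ → ℝ) : ℕ → ℝ
  | 0 => 0
  | n + 1 => b n / b (n + 1)

/-- A positive log-concave sequence of coefficients, nondecreasing. -/
structure IsLogConcaveSeq (b : ℕ → ℝ) : Prop where
  pos : ∀ n, 0 < b n
  le_succ : ∀ n, b n ≤ b (n + 1)
  logConcave : ∀ n, b n * b (n + 2) ≤ b (n + 1) ^ 2

namespace IsLogConcaveSeq

variable {b : ℕ → ℝ} (hb : IsLogConcaveSeq b)
include hb

lemma crossingRadius_nonneg (n : ℕ) : 0 ≤ crossingRadius b n := by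
  cases n with
  | zero => exact le_rfl
  | succ n => exact div_nonneg (hb.pos _).le (hb.pos _).le

lemma crossingRadius_succ_pos (n : ℕ) : 0 < crossingRadius b (n + 1) :=
  div_pos (hb.pos _) (hb.pos _)

lemma crossingRadius_le_one (n : ℕ) : crossingRadius b n ≤ 1 := by
  cases n with
  | zero => exact zero_le_one
  | succ n => exact (div_le_one (hb.pos _)).2 (hb.le_succ n)

lemma crossingRadius_mono : Monotone (crossingRadius b) := by
  refine monotone_nat_of_le_succ fun n => ?_
  cases n with
  | zero => exact hb.crossingRadius_nonneg 1
  | succ n =>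
    simp only [crossingRadius]
    rw [div_le_div_iff₀ (hb.pos _) (hb.pos _)]
    have := hb.logConcave n
    rw [pow_two] at this
    exact this

lemma term_le_term_succ {m : ℕ} {r : ℝ} (hr0 : 0 ≤ r) (hr : crossingRadius b (m + 1) ≤ r) :
    b m * r ^ m ≤ b (m + 1) * r ^ (m + 1) := by
  have h : b m ≤ r * b (m + 1) := (div_le_iff₀ (hb.pos _)).1 hr
  calc b m * r ^ m ≤ r * b (m + 1) * r ^ m := by gcongr
    _ = _ := by ring

lemma term_succ_le_term {m : ℕ} {r : ℝ} (hr0 : 0 ≤ r) (hr : r ≤ crossingRadius b (m + 1)) :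
    b (m + 1) * r ^ (m + 1) ≤ b m * r ^ m := by
  have h : r * b (m + 1) ≤ b m := (le_div_iff₀ (hb.pos _)).1 hr
  calc b (m + 1) * r ^ (m + 1) = r * b (m + 1) * r ^ m := by ring
    _ ≤ _ := by gcongr

lemma term_le_of_le {i j : ℕ} {r : ℝ} (hij : i ≤ j) (hr : crossingRadius b j ≤ r) :
    b i * r ^ i ≤ b j * r ^ j := by
  have hr0 := (hb.crossingRadius_nonneg j).trans hr
  induction j, hij using Nat.le_induction with
  | base => exact le_rfl
  | succ n hn ih =>
    exact (ih ((hb.crossingRadius_mono n.le_succ).trans hr)).trans (hb.term_le_term_succ hr0 hr)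

lemma term_le_of_ge {i j : ℕ} {r : ℝ} (hr0 : 0 ≤ r) (hij : j ≤ i)
    (hr : r ≤ crossingRadius b (j + 1)) : b i * r ^ i ≤ b j * r ^ j := by
  induction i, hij using Nat.le_induction with
  | base => exact le_rfl
  | succ n hn ih =>
    exact (hb.term_succ_le_term hr0
      (hr.trans (hb.crossingRadius_mono (Nat.succ_le_succ hn)))).trans ih

/-- Crossing radii increase by log-concavity, so at a fixed radius the terms rise up to index `j`
and fall afterwards. -/
lemma term_le_of_mem {j : ℕ} {r : ℝ} (h1 : crossingRadius b j ≤ r)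
    (h2 : r ≤ crossingRadius b (j + 1)) (i : ℕ) : b i * r ^ i ≤ b j * r ^ j := by
  rcases le_total i j with h | h
  · exact hb.term_le_of_le h h1
  · exact hb.term_le_of_ge ((hb.crossingRadius_nonneg j).trans h1) h h2

end IsLogConcaveSeq

/-- The indices `n < m` are `ε`-separated: each of the two terms dominates the other by the factor
`1 / ε` at its own crossing radius. -/
def Separated (b : ℕ → ℝ) (ε : ℝ) (n m : ℕ) : Prop :=
  n < m ∧ b m * crossingRadius b n ^ m ≤ ε * (b n * crossingRadius b n ^ n) ∧
    b n * crossingRadius b m ^ n ≤ ε * (b m * crossingRadius b m ^ m)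

namespace IsLogConcaveSeq

variable {b : ℕ → ℝ} (hb : IsLogConcaveSeq b)
include hb

omit hb in
lemma exists_crossingRadius_mem {n m : ℕ} (hnm : n < m) {r : ℝ} (h1 : crossingRadius b n ≤ r)
    (h2 : r ≤ crossingRadius b m) :
    ∃ j, n ≤ j ∧ j < m ∧ crossingRadius b j ≤ r ∧ r ≤ crossingRadius b (j + 1) := by
  induction m, hnm using Nat.le_induction with
  | base => exact ⟨n, le_rfl, n.lt_succ_self, h1, h2⟩
  | succ m hm ih =>
    rcases le_total r (crossingRadius b m) with h | h
    · obtain ⟨j, a, c, e⟩ := ih h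
      exact ⟨j, a, c.trans m.lt_succ_self, e⟩
    · exact ⟨m, (Nat.le_succ n).trans hm, m.lt_succ_self, h, h2⟩

/-- Between consecutive greedily separated indices, the two corresponding terms control all. -/
lemma term_le_max_of_least_separated {ε : ℝ} (hε : 0 < ε) (hε1 : ε ≤ 1) {n m : ℕ} (hnm : n < m)
    (hleast : ∀ q, q < m → ¬ Separated b ε n q) {r : ℝ} (h1 : crossingRadius b n ≤ r)
    (h2 : r ≤ crossingRadius b m) (i : ℕ) :
    b i * r ^ i ≤ 1 / ε * (1 / crossingRadius b 1) * max (b n * r ^ n) (b m * r ^ m) := by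
  have hr0 := (hb.crossingRadius_nonneg n).trans h1
  have hρ1 : 0 < crossingRadius b 1 := hb.crossingRadius_succ_pos 0
  have hρ1' : 1 ≤ 1 / crossingRadius b 1 := by
    rw [le_div_iff₀ hρ1, one_mul]; exact hb.crossingRadius_le_one 1
  have hε' : 1 ≤ 1 / ε := by rw [le_div_iff₀ hε, one_mul]; exact hε1
  have hn0 : 0 ≤ b n * r ^ n := mul_nonneg (hb.pos n).le (pow_nonneg hr0 _)
  have hm0 : 0 ≤ b m * r ^ m := mul_nonneg (hb.pos m).le (pow_nonneg hr0 _)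
  have hmax0 : 0 ≤ max (b n * r ^ n) (b m * r ^ m) := le_max_of_le_left hn0
  have fromn : ∀ x, x ≤ 1 / ε * (b n * r ^ n) →
      x ≤ 1 / ε * (1 / crossingRadius b 1) * max (b n * r ^ n) (b m * r ^ m) := fun x hx =>
    calc x ≤ 1 / ε * 1 * (b n * r ^ n) := by rw [mul_one]; exact hx
      _ ≤ _ := by gcongr; exact le_max_left _ _
  -- Minimality of `m` gives information only about `q = m - 1`. Passing from term `q` to term `m`
  -- costs the factor `1 / crossingRadius b 1`, because `b` is nondecreasing and `r ≥ crossingRadius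
  -- b 1`.
  have fromq : ∀ q, q + 1 = m → crossingRadius b 1 ≤ r → ∀ x, x ≤ 1 / ε * (b q * r ^ q) →
      x ≤ 1 / ε * (1 / crossingRadius b 1) * max (b n * r ^ n) (b m * r ^ m) := by
    rintro q rfl hr x hx
    have hbq : b q ≤ b (q + 1) := hb.le_succ q
    calc x ≤ 1 / ε * (b q * r ^ q) := hx
      _ ≤ 1 / ε * (b (q + 1) * r ^ q) := by gcongr
      _ ≤ 1 / ε * (b (q + 1) * (r ^ q * (r / crossingRadius b 1))) := by
          have : r ^ q * 1 ≤ r ^ q * (r / crossingRadius b 1) := by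
            gcongr
            exact (one_le_div hρ1).2 hr
          rw [mul_one] at this
          have := hb.pos (q + 1)
          gcongr
      _ = 1 / ε * (1 / crossingRadius b 1) * (b (q + 1) * r ^ (q + 1)) := by ring
      _ ≤ _ := by gcongr; exact le_max_right _ _
  obtain ⟨j, hnj, hjm, hj1, hj2⟩ := exists_crossingRadius_mem hnm h1 h2
  refine (hb.term_le_of_mem hj1 hj2 i).trans ?_
  have hj0 : 0 ≤ b j * r ^ j := mul_nonneg (hb.pos j).le (pow_nonneg hr0 _)
  have one_mul_le : ∀ y : ℝ, 0 ≤ y → y ≤ 1 / ε * y := fun y hy => le_mul_of_one_le_left hy hε'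
  obtain ⟨q, rfl⟩ : ∃ q, m = q + 1 := ⟨m - 1, by omega⟩
  rcases eq_or_lt_of_le hnj with rfl | hnj'
  · exact fromn _ (one_mul_le _ hj0)
  rcases eq_or_lt_of_le (Nat.lt_succ_iff.1 hjm) with rfl | hjq
  · exact fromq j rfl ((hb.crossingRadius_mono (by omega)).trans hj1) _ (one_mul_le _ hj0)
  have hnq : n < q := hnj'.trans hjq
  have hns := hleast q q.lt_succ_self
  simp only [Separated, hnq, true_and, not_and_or, not_le] at hns
  -- Each failure of separation makes a term at least `ε` times the maximal one at a crossing
  -- radius: term `q` at that of `n`, carried to larger radii, or term `n` at that of `q`, carried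
  -- to smaller ones.
  rcases hns with hns | hns
  -- Index `0` has crossing radius `0`, where term `q` vanishes, so this alternative forces `n ≥ 1`.
  · have hnpos : n ≠ 0 := by
      rintro rfl
      simp only [crossingRadius, zero_pow hnq.ne', mul_zero, pow_zero, mul_one] at hns
      exact absurd hns (not_lt.2 (mul_pos hε (hb.pos 0)).le)
    have hρn1 : crossingRadius b 1 ≤ crossingRadius b n :=
      hb.crossingRadius_mono (Nat.one_le_iff_ne_zero.2 hnpos)
    refine fromq q rfl (hρn1.trans h1) _ ?_
    rw [← mul_assoc]
    refine monomial_le_of_le_of_le (by have := hb.pos q; positivity) (hρ1.trans_le hρn1) h1 hjq.le ?_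
    refine (hb.term_le_of_mem le_rfl (hb.crossingRadius_mono n.le_succ) j).trans ?_
    rw [mul_assoc, div_mul_eq_mul_div, le_div_iff₀ hε, one_mul, mul_comm]
    exact hns.le
  · refine fromn _ ?_
    have hρq : r ≤ crossingRadius b q := hj2.trans (hb.crossingRadius_mono hjq)
    have hρq0 : 0 < crossingRadius b q :=
      hρ1.trans_le (hb.crossingRadius_mono (by omega))
    rw [← mul_assoc]
    refine monomial_le_of_ge_of_le (hb.pos j).le hr0 hρq0 hρq hnj ?_
    refine (hb.term_le_of_mem le_rfl (hb.crossingRadius_mono q.le_succ) j).trans ?_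
    rw [mul_assoc, div_mul_eq_mul_div, le_div_iff₀ hε, one_mul, mul_comm]
    exact hns.le

end IsLogConcaveSeq

/-! ### Monomial minorants of a log-convex weight -/

/-- The largest coefficient `b` such that `b r ^ n ≤ v r` for `0 < r < 1`. -/
noncomputable def minorantCoeff (v : ℝ → ℝ) (n : ℕ) : ℝ :=
  sInf ((fun r => v r / r ^ n) '' Ioo 0 1)

namespace IsWeight

variable {v : ℝ → ℝ} (hv : IsWeight v)
include hv

lemma zero_pos : 0 < v 0 := hv.pos 0 ⟨le_rfl, one_pos⟩

lemma zero_le {r : ℝ} (hr : r ∈ Ico (0 : ℝ) 1) : v 0 ≤ v r :=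
  hv.monotoneOn ⟨le_rfl, one_pos⟩ hr hr.1

lemma zero_le_div_pow (n : ℕ) {r : ℝ} (hr : r ∈ Ioo (0 : ℝ) 1) : v 0 ≤ v r / r ^ n := by
  rw [le_div_iff₀ (pow_pos hr.1 n)]
  calc v 0 * r ^ n ≤ v 0 * 1 := by
        have := hv.zero_pos
        gcongr
        exact pow_le_one₀ hr.1.le hr.2.le
    _ ≤ v r := by rw [mul_one]; exact hv.zero_le ⟨hr.1.le, hr.2⟩

lemma bddBelow_div_pow (n : ℕ) : BddBelow ((fun r => v r / r ^ n) '' Ioo 0 1) :=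
  ⟨v 0, by rintro _ ⟨r, hr, rfl⟩; exact hv.zero_le_div_pow n hr⟩

omit hv in
lemma nonempty_div_pow (n : ℕ) : ((fun r => v r / r ^ n) '' Ioo 0 1).Nonempty :=
  (nonempty_Ioo.2 one_pos).image _

lemma minorantCoeff_ge (n : ℕ) : v 0 ≤ minorantCoeff v n :=
  le_csInf (nonempty_div_pow n) (by rintro _ ⟨r, hr, rfl⟩; exact hv.zero_le_div_pow n hr)

lemma minorantCoeff_le_div (n : ℕ) {r : ℝ} (hr : r ∈ Ioo (0 : ℝ) 1) :
    minorantCoeff v n ≤ v r / r ^ n :=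
  csInf_le (hv.bddBelow_div_pow n) ⟨r, hr, rfl⟩

lemma minorantCoeff_mul_pow_le (n : ℕ) {r : ℝ} (hr : r ∈ Ico (0 : ℝ) 1) :
    minorantCoeff v n * r ^ n ≤ v r := by
  rcases eq_or_lt_of_le hr.1 with rfl | h0
  · cases n with
    | succ n => simpa using hv.zero_pos.le
    | zero =>
      -- The infimum sees only `r > 0`; the value at `0` is reached by continuity.
      have hc : Filter.Tendsto v (nhdsWithin 0 (Ioo 0 1)) (nhds (v 0)) :=
        (hv.continuousOn 0 hr).mono_left (nhdsWithin_mono _ Ioo_subset_Ico_self)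
      have hne : (nhdsWithin (0 : ℝ) (Ioo 0 1)).NeBot := by
        rw [nhdsWithin_Ioo_eq_nhdsGT one_pos]; infer_instance
      refine ge_of_tendsto hc ?_
      filter_upwards [self_mem_nhdsWithin] with r hr
      simpa using hv.minorantCoeff_le_div 0 hr
  · exact (le_div_iff₀ (pow_pos h0 n)).1 (hv.minorantCoeff_le_div n ⟨h0, hr.2⟩)

/-- For fixed `r`, `log (v r / r ^ n)` is affine and increasing in `n`; infima inherit concavity and
monotonicity. -/
lemma isLogConcaveSeq_minorantCoeff : IsLogConcaveSeq (minorantCoeff v) where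
  pos n := hv.zero_pos.trans_le (hv.minorantCoeff_ge n)
  le_succ n := by
    refine le_csInf (nonempty_div_pow _) ?_
    rintro _ ⟨r, hr, rfl⟩
    refine (hv.minorantCoeff_le_div n hr).trans ?_
    refine div_le_div_of_nonneg_left (hv.pos r ⟨hr.1.le, hr.2⟩).le (pow_pos hr.1 _) ?_
    exact pow_le_pow_of_le_one hr.1.le hr.2.le n.le_succ
  logConcave n := by
    have hpos : ∀ k, 0 < minorantCoeff v k := fun k => hv.zero_pos.trans_le (hv.minorantCoeff_ge k)
    have key : Real.sqrt (minorantCoeff v n * minorantCoeff v (n + 2)) ≤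
        minorantCoeff v (n + 1) := by
      refine le_csInf (nonempty_div_pow _) ?_
      rintro _ ⟨r, hr, rfl⟩
      have hvr := hv.pos r ⟨hr.1.le, hr.2⟩
      have hrp : 0 < r := hr.1
      refine Real.sqrt_le_iff.2 ⟨by positivity, ?_⟩
      calc minorantCoeff v n * minorantCoeff v (n + 2)
          ≤ (v r / r ^ n) * (v r / r ^ (n + 2)) :=
            mul_le_mul (hv.minorantCoeff_le_div n hr) (hv.minorantCoeff_le_div _ hr)
              (hpos _).le (by positivity)
        _ = (v r / r ^ (n + 1)) ^ 2 := by field_simp; ring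
    have := pow_le_pow_left₀ (Real.sqrt_nonneg _) key 2
    rwa [Real.sq_sqrt (mul_pos (hpos _) (hpos _)).le] at this

end IsWeight

namespace IsLogConvexWeight

variable {v : ℝ → ℝ} (hv : IsLogConvexWeight v)
include hv

/-- A supporting line of `log v (exp t)` at a point; its slope is nonnegative. -/
lemma exists_support {s : ℝ} (hs : s < 0) : ∃ β : ℝ, 0 ≤ β ∧ ∀ u < 0,
    Real.log (v (Real.exp s)) + β * (u - s) ≤ Real.log (v (Real.exp u)) := by
  set Φ : ℝ → ℝ := fun t => Real.log (v (Real.exp t))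
  have hc : ConvexOn ℝ (Iio (0 : ℝ)) Φ := hv.logConvex
  have hsi : s ∈ interior (Iio (0 : ℝ)) := by rw [interior_Iio]; exact hs
  set β := derivWithin Φ (Ioi s) s
  have hright : ∀ u < 0, s < u → Φ s + β * (u - s) ≤ Φ u := fun u hu hsu => by
    have h := hc.rightDeriv_le_slope_of_mem_interior hsi hu hsu
    rw [slope_def_field, le_div_iff₀ (sub_pos.2 hsu)] at h
    linarith
  have hleft : ∀ u < s, Φ s + β * (u - s) ≤ Φ u := fun u hus => by
    have h := (hc.slope_le_leftDeriv_of_mem_interior (hus.trans hs) hsi hus).trans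
      (hc.leftDeriv_le_rightDeriv_of_mem_interior hsi)
    rw [slope_def_field, div_le_iff₀ (sub_pos.2 hus)] at h
    have : Φ s - Φ u ≤ β * (s - u) := h
    linarith
  refine ⟨β, ?_, fun u hu => ?_⟩
  · have h1 := hleft (s - 1) (by linarith)
    have h2 : Φ (s - 1) ≤ Φ s := by
      have hm : ∀ t < 0, Real.exp t ∈ Ico (0 : ℝ) 1 := fun t ht =>
        ⟨(Real.exp_pos t).le, by rw [← Real.exp_zero]; exact Real.exp_lt_exp.2 ht⟩
      refine Real.log_le_log (hv.pos _ (hm _ (by linarith))) ?_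
      exact hv.monotoneOn (hm _ (by linarith)) (hm _ hs) (Real.exp_le_exp.2 (by linarith))
    linarith
  · rcases lt_trichotomy u s with h | rfl | h
    · exact hleft u h
    · simp
    · exact hright u hu h

/-- A supporting line of slope `β` at `log r` would give equality with exponent `β`. Rounding up to
`⌈β⌉₊ < β + 1` preserves the minorant, as `log x < 0`, and loses at most a factor `r`. -/
lemma exists_mul_le_minorant {r : ℝ} (hr : r ∈ Ioo (0 : ℝ) 1) :
    ∃ n, r * v r ≤ minorantCoeff v n * r ^ n := by
  have hr0 : 0 < r := hr.1
  have hs : Real.log r < 0 := Real.log_neg hr.1 hr.2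
  obtain ⟨β, hβ, h⟩ := hv.exists_support hs
  rw [Real.exp_log hr.1] at h
  have hvr := hv.pos r ⟨hr.1.le, hr.2⟩
  refine ⟨⌈β⌉₊, ?_⟩
  rw [← div_le_iff₀ (pow_pos hr.1 _)]
  refine le_csInf (IsWeight.nonempty_div_pow _) ?_
  rintro _ ⟨x, hx, rfl⟩
  have hx0 : 0 < x := hx.1
  have hvx := hv.pos x ⟨hx.1.le, hx.2⟩
  have hu : Real.log x < 0 := Real.log_neg hx.1 hx.2
  have hh := h _ hu
  rw [Real.exp_log hx.1] at hh
  rw [← Real.log_le_log_iff (by positivity) (by positivity), Real.log_div (by positivity)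
    (by positivity), Real.log_div (by positivity) (by positivity), Real.log_mul (by positivity)
    (by positivity), Real.log_pow, Real.log_pow]
  have c1 := Nat.le_ceil β
  have c2 := Nat.ceil_lt_add_one hβ
  nlinarith [mul_nonneg (sub_nonneg.2 c1) (neg_nonneg.2 hu.le),
    mul_nonneg (sub_nonneg.2 c2.le) (neg_nonneg.2 hs.le)]

lemma exists_le_minorant : ∃ K : ℝ, 0 < K ∧ ∀ r ∈ Ico (0 : ℝ) 1,
    ∃ n, v r ≤ K * (minorantCoeff v n * r ^ n) := by
  have h0 := hv.zero_pos
  have hhalf : (1 / 2 : ℝ) ∈ Ico (0 : ℝ) 1 := by constructor <;> norm_num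
  have hpos := hv.pos _ hhalf
  -- The lost factor `r` costs at most `2` for `r ≥ 1 / 2`; below `1 / 2` the constant minorant
  -- suffices.
  refine ⟨max 2 (v (1 / 2) / v 0), by positivity, fun r hr => ?_⟩
  rcases le_total r (1 / 2) with h | h
  · refine ⟨0, (hv.monotoneOn hr hhalf h).trans ?_⟩
    calc v (1 / 2) = v (1 / 2) / v 0 * v 0 := by field_simp
      _ ≤ max 2 (v (1 / 2) / v 0) * (minorantCoeff v 0 * r ^ 0) := by
          rw [pow_zero, mul_one]
          exact mul_le_mul (le_max_right _ _) (hv.minorantCoeff_ge 0) h0.le (by positivity)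
  · obtain ⟨n, hn⟩ := hv.exists_mul_le_minorant (r := r) ⟨by linarith, hr.2⟩
    refine ⟨n, ?_⟩
    have hvr := hv.pos r hr
    calc v r ≤ 2 * (r * v r) := by nlinarith
      _ ≤ max 2 (v (1 / 2) / v 0) * (r * v r) := by
          have : 0 ≤ r * v r := mul_nonneg hr.1 hvr.le
          gcongr; exact le_max_left _ _
      _ ≤ _ := by gcongr

end IsLogConvexWeight

/-! ### Lacunary selection -/

section Selection

variable {v : ℝ → ℝ} (hv : IsLogConvexWeight v) (hunb : ∀ C, ∃ r ∈ Ico (0 : ℝ) 1, C < v r)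
include hv hunb

/-- If the radius were `1`, term `n` would be maximal at `r = 1`, which bounds all terms and hence
`v`. -/
lemma IsLogConvexWeight.crossingRadius_lt_one (n : ℕ) :
    crossingRadius (minorantCoeff v) n < 1 := by
  have hb := hv.isLogConcaveSeq_minorantCoeff
  obtain ⟨K, hK, hle⟩ := hv.exists_le_minorant
  by_contra hcon
  have h1 : crossingRadius (minorantCoeff v) n = 1 :=
    le_antisymm (hb.crossingRadius_le_one n) (not_lt.1 hcon)
  obtain ⟨r, hr, hlt⟩ := hunb (K * (minorantCoeff v n * 1 ^ n))
  obtain ⟨i, hi⟩ := hle r hr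
  have h2 : minorantCoeff v i * (1 : ℝ) ^ i ≤ minorantCoeff v n * 1 ^ n :=
    hb.term_le_of_mem h1.le (h1.symm.le.trans (hb.crossingRadius_mono n.le_succ)) i
  have h3 : minorantCoeff v i * r ^ i ≤ minorantCoeff v i * 1 ^ i := by
    have := (hb.pos i).le
    have := hr.1
    have := hr.2.le
    gcongr
  have : K * (minorantCoeff v i * r ^ i) ≤ K * (minorantCoeff v n * 1 ^ n) :=
    mul_le_mul_of_nonneg_left (h3.trans h2) hK.le
  linarith

omit hunb in
-- Otherwise the terms at `r` never drop below the constant one, so at a larger `R < 1` they grow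
-- like `(R / r) ^ n`, past the bound `v R`.
lemma IsLogConvexWeight.exists_lt_crossingRadius {r : ℝ} (hr : r < 1) :
    ∃ M, ∀ m, M ≤ m → r < crossingRadius (minorantCoeff v) m := by
  have hb := hv.isLogConcaveSeq_minorantCoeff
  suffices h : ∃ M, r < crossingRadius (minorantCoeff v) M by
    obtain ⟨M, hM⟩ := h
    exact ⟨M, fun m hm => hM.trans_le (hb.crossingRadius_mono hm)⟩
  by_contra! hcon
  have hr0 : 0 < r := (hb.crossingRadius_succ_pos 0).trans_le (hcon 1)
  obtain ⟨R, hrR, hR⟩ := exists_between hr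
  have hRm : R ∈ Ico (0 : ℝ) 1 := ⟨(hr0.trans hrR).le, hR⟩
  have h0 : ∀ n, minorantCoeff v 0 ≤ minorantCoeff v n * r ^ n := fun n => by
    have := hb.term_le_of_le (Nat.zero_le n) (hcon n)
    simpa using this
  have h1 : ∀ n, minorantCoeff v 0 * (R / r) ^ n ≤ v R := fun n => by
    refine le_trans ?_ (hv.minorantCoeff_mul_pow_le n hRm)
    calc minorantCoeff v 0 * (R / r) ^ n ≤ minorantCoeff v n * r ^ n * (R / r) ^ n := by
          have := (hr0.trans hrR).le
          gcongr
          exact h0 n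
      _ = _ := by rw [div_pow]; field_simp
  obtain ⟨n, hn⟩ := pow_unbounded_of_one_lt (v R / minorantCoeff v 0) ((one_lt_div hr0).2 hrR)
  rw [div_lt_iff₀ (hb.pos 0)] at hn
  have := h1 n
  linarith

/-- Some term reaches `B` at some `r < 1`. For large `m` the crossing radius exceeds `r`, and there
term `m` is the maximal one. -/
lemma IsLogConvexWeight.exists_le_term_crossingRadius (B : ℝ) :
    ∃ M, ∀ m, M ≤ m →
      B ≤ minorantCoeff v m * crossingRadius (minorantCoeff v) m ^ m := by
  have hb := hv.isLogConcaveSeq_minorantCoeff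
  obtain ⟨K, hK, hle⟩ := hv.exists_le_minorant
  obtain ⟨r, hr, hlt⟩ := hunb (K * B)
  obtain ⟨i, hi⟩ := hle r hr
  obtain ⟨M, hM⟩ := hv.exists_lt_crossingRadius hr.2
  refine ⟨M, fun m hm => ?_⟩
  have h1 : B ≤ minorantCoeff v i * r ^ i := le_of_mul_le_mul_left (hlt.le.trans hi) hK
  refine h1.trans (le_trans ?_ (hb.term_le_of_mem le_rfl (hb.crossingRadius_mono m.le_succ) i))
  have := (hb.pos i).le
  have := hr.1
  have := (hM m hm).le
  gcongr

/-- Both inequalities hold for all large `m`: at the crossing radius of `n`, which is below `1`, the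
terms decay geometrically, while at its own crossing radius term `m` tends to infinity and term `n`
stays below `b n`. -/
lemma IsLogConvexWeight.exists_separated {ε : ℝ} (hε : 0 < ε) (n : ℕ) :
    ∃ m, Separated (minorantCoeff v) ε n m := by
  have hb := hv.isLogConcaveSeq_minorantCoeff
  set b := minorantCoeff v
  have hρ1 := hv.crossingRadius_lt_one hunb n
  have hρ0 := hb.crossingRadius_nonneg n
  obtain ⟨M₁, hM₁⟩ := hv.exists_le_term_crossingRadius hunb (b n / ε)
  obtain ⟨M₂, hM₂⟩ : ∃ M, ∀ m, M ≤ m →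
      b m * crossingRadius b n ^ m ≤ ε * (b n * crossingRadius b n ^ n) := by
    rcases eq_or_lt_of_le hρ0 with h | h
    · refine ⟨1, fun m hm => ?_⟩
      rw [← h, zero_pow (by omega), mul_zero]
      have := (hb.pos n).le
      positivity
    · obtain ⟨R, hrR, hR⟩ := exists_between hρ1
      have hR0 : 0 < R := h.trans hrR
      have hvR := hv.pos R ⟨hR0.le, hR⟩
      have hpos : 0 < ε * (b n * crossingRadius b n ^ n) / v R := by
        have := hb.pos n
        positivity
      obtain ⟨M, hM⟩ := exists_pow_lt_of_lt_one hpos ((div_lt_one hR0).2 hrR)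
      refine ⟨M, fun m hm => ?_⟩
      have hq : (crossingRadius b n / R) ^ m ≤ (crossingRadius b n / R) ^ M :=
        pow_le_pow_of_le_one (by positivity) ((div_lt_one hR0).2 hrR).le hm
      calc b m * crossingRadius b n ^ m = b m * R ^ m * (crossingRadius b n / R) ^ m := by
            rw [div_pow]; field_simp
        _ ≤ v R * (ε * (b n * crossingRadius b n ^ n) / v R) :=
            mul_le_mul (hv.minorantCoeff_mul_pow_le m ⟨hR0.le, hR⟩) (hq.trans hM.le)
              (by positivity) hvR.le
        _ = _ := by field_simp
  refine ⟨max (n + 1) (max M₁ M₂), by omega, hM₂ _ (by omega), ?_⟩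
  have h := hM₁ (max (n + 1) (max M₁ M₂)) (by omega)
  rw [div_le_iff₀ hε] at h
  calc b n * crossingRadius b (max (n + 1) (max M₁ M₂)) ^ n ≤ b n * 1 := by
        have := (hb.pos n).le
        gcongr
        exact pow_le_one₀ (hb.crossingRadius_nonneg _) (hb.crossingRadius_le_one _)
    _ ≤ _ := by rw [mul_one, mul_comm ε]; exact h

/-- An unbounded log-convex weight is comparable to the larger of two consecutive terms of a
lacunary sequence of monomials whose remaining terms decay geometrically. -/
theorem IsLogConvexWeight.exists_lacunary {ε : ℝ} (hε : 0 < ε) (hε1 : ε ≤ 1) :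
    ∃ (N : ℕ → ℕ) (a : ℕ → ℝ) (K : ℝ), StrictMono N ∧ (∀ k, 0 < a k) ∧ 0 < K ∧
      (∀ k, ∀ r ∈ Ico (0 : ℝ) 1, a k * r ^ N k ≤ v r) ∧
      ∀ r ∈ Ico (0 : ℝ) 1, ∃ k,
        (∀ j, k + 1 ≤ j → a (j + 1) * r ^ N (j + 1) ≤ ε * (a j * r ^ N j)) ∧
        (∀ j, j < k → a j * r ^ N j ≤ ε * (a (j + 1) * r ^ N (j + 1))) ∧
        v r ≤ K * max (a k * r ^ N k) (a (k + 1) * r ^ N (k + 1)) := by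
  classical
  have hb := hv.isLogConcaveSeq_minorantCoeff
  have hex := hv.exists_separated hunb hε
  obtain ⟨K, hK, hle⟩ := hv.exists_le_minorant
  have hexlt := fun {r : ℝ} (hr : r < 1) => hv.exists_lt_crossingRadius hr
  have hmin := fun k (r : ℝ) (hr : r ∈ Ico (0 : ℝ) 1) => hv.minorantCoeff_mul_pow_le k hr
  set b := minorantCoeff v
  -- Greedy choice: the next index is the least one separated from the current one.
  let N : ℕ → ℕ := fun k => Nat.rec 0 (fun _ n => Nat.find (hex n)) k
  have hN0 : N 0 = 0 := rfl
  have hNs : ∀ k, N (k + 1) = Nat.find (hex (N k)) := fun _ => rfl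
  have hsep : ∀ k, Separated b ε (N k) (N (k + 1)) := fun k => by
    rw [hNs]; exact Nat.find_spec (hex (N k))
  have hmono : StrictMono N := strictMono_nat_of_lt_succ fun k => (hsep k).1
  refine ⟨N, fun k => b (N k), K * (1 / ε * (1 / crossingRadius b 1)), hmono, fun k => hb.pos _,
    ?_, fun k r hr => hmin _ r hr, fun r hr => ?_⟩
  · have := hb.crossingRadius_succ_pos 0
    positivity
  have hex' : ∃ k, r < crossingRadius b (N (k + 1)) := by
    obtain ⟨M, hM⟩ := hexlt hr.2
    exact ⟨M, hM _ (M.le_succ.trans (hmono.id_le _))⟩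
  set k := Nat.find hex'
  have hk2 : r < crossingRadius b (N (k + 1)) := Nat.find_spec hex'
  have hk1 : crossingRadius b (N k) ≤ r := by
    rcases Nat.eq_zero_or_pos k with h | h
    · rw [h, hN0]; exact hr.1
    · have := Nat.find_min hex' (m := k - 1) (by omega)
      rw [not_lt, Nat.sub_add_cancel h] at this
      exact this
  -- Here `r` lies between the crossing radii of `N k` and `N (k + 1)`. Separation spreads downwards
  -- from the crossing radius of the lower index and upwards from that of the higher one.
  refine ⟨k, fun j hj => ?_, fun j hj => ?_, ?_⟩
  · have hjr : r ≤ crossingRadius b (N j) :=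
      hk2.le.trans (hb.crossingRadius_mono (hmono.monotone hj))
    have hpos : 0 < crossingRadius b (N j) := hr.1.trans_lt (hk2.trans_le
      (hb.crossingRadius_mono (hmono.monotone hj)))
    have := (hsep j).2.1
    rw [← mul_assoc] at this ⊢
    exact monomial_le_of_ge_of_le (hb.pos _).le hr.1 hpos hjr (hsep j).1.le this
  · have hjr : crossingRadius b (N (j + 1)) ≤ r :=
      (hb.crossingRadius_mono (hmono.monotone hj)).trans hk1
    have hpos : 0 < crossingRadius b (N (j + 1)) :=
      (hb.crossingRadius_succ_pos 0).trans_le (hb.crossingRadius_mono (by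
        have := (hsep j).1
        omega))
    have := (hsep j).2.2
    rw [← mul_assoc] at this ⊢
    have hb' := (hb.pos (N (j + 1))).le
    exact monomial_le_of_le_of_le (by positivity) hpos hjr (hsep j).1.le this
  · obtain ⟨i, hi⟩ := hle r hr
    refine hi.trans ?_
    rw [mul_assoc]
    have hl : ∀ q, q < N (k + 1) → ¬ Separated b ε (N k) q := fun q hq =>
      Nat.find_min (hex (N k)) hq
    have := hb.term_le_max_of_least_separated hε hε1 (hsep k).1 hl hk1 hk2.le i
    gcongr

end Selection

/-! ### Sub-mean value properties and log-convexity -/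

/-- A continuous function on an interval satisfying the averaging inequality
`h s ≤ ⨍ h (s + ρ cos t) dt` obeys the maximum principle. -/
lemma le_of_le_cosAverage {h : ℝ → ℝ} {a b M : ℝ} (hab : a ≤ b) (hc : ContinuousOn h (Icc a b))
    (ha : h a ≤ M) (hb : h b ≤ M)
    (hsub : ∀ s ρ, 0 < ρ → a ≤ s - ρ → s + ρ ≤ b →
      2 * Real.pi * h s ≤ ∫ t in (0 : ℝ)..2 * Real.pi, h (s + ρ * Real.cos t)) :
    ∀ s ∈ Icc a b, h s ≤ M := by
  obtain ⟨m, hm, hmax⟩ := isCompact_Icc.exists_isMaxOn (nonempty_Icc.2 hab) hc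
  by_contra! hcon
  obtain ⟨s, hs, hsM⟩ := hcon
  have hmM : M < h m := hsM.trans_le (hmax hs)
  have hcl : IsCompact {x ∈ Icc a b | h m ≤ h x} := by
    refine isCompact_Icc.of_isClosed_subset ?_ (sep_subset _ _)
    exact hc.preimage_isClosed_of_isClosed isClosed_Icc isClosed_Ici
  -- At the leftmost maximum point the average is strictly smaller than the value, because `t = π`
  -- samples a point further left.
  obtain ⟨x, ⟨hx, hxm⟩, hleast⟩ := hcl.exists_isLeast ⟨m, hm, le_rfl⟩
  have hxa : a < x := lt_of_le_of_ne hx.1 (by rintro rfl; linarith)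
  have hxb : x < b := lt_of_le_of_ne hx.2 (by rintro rfl; linarith)
  set ρ := min (x - a) (b - x)
  have hρ : 0 < ρ := lt_min (by linarith) (by linarith)
  have hρa : ρ ≤ x - a := min_le_left _ _
  have hρb : ρ ≤ b - x := min_le_right _ _
  have key := hsub x ρ hρ (by linarith) (by linarith)
  have hmem : ∀ t, x + ρ * Real.cos t ∈ Icc a b := fun t => by
    have h1 := Real.cos_le_one t
    have h2 := Real.neg_one_le_cos t
    constructor <;> nlinarith
  have hcont : Continuous fun t => h (x + ρ * Real.cos t) :=
    hc.comp_continuous (by fun_prop) hmem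
  have hlt : (∫ t in (0 : ℝ)..2 * Real.pi, h (x + ρ * Real.cos t)) <
      ∫ _ in (0 : ℝ)..2 * Real.pi, h x := by
    refine intervalIntegral.integral_lt_integral_of_continuousOn_of_le_of_exists_lt
      (by positivity) hcont.continuousOn continuousOn_const
      (fun t _ => (hmax (hmem t)).trans hxm) ⟨Real.pi, ⟨Real.pi_pos.le, by
        linarith [Real.pi_pos]⟩, ?_⟩
    by_contra! hge
    have := hleast ⟨hmem Real.pi, hxm.trans hge⟩
    rw [Real.cos_pi] at this
    linarith
  rw [intervalIntegral.integral_const, smul_eq_mul, sub_zero] at hlt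
  linarith

/-- If all exponential tilts of `Ψ > 0` obey the averaging inequality, then `log Ψ` is convex. -/
lemma convexOn_log_of_le_cosAverage {Ψ : ℝ → ℝ} (hc : ContinuousOn Ψ (Iio 0))
    (hpos : ∀ s < 0, 0 < Ψ s)
    (hsub : ∀ a s ρ : ℝ, 0 < ρ → s + ρ < 0 →
      2 * Real.pi * (Real.exp (a * s) * Ψ s) ≤
        ∫ t in (0 : ℝ)..2 * Real.pi,
          Real.exp (a * (s + ρ * Real.cos t)) * Ψ (s + ρ * Real.cos t)) :
    ConvexOn ℝ (Iio (0 : ℝ)) (fun s => Real.log (Ψ s)) := by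
  refine LinearOrder.convexOn_of_lt (convex_Iio 0) fun x hx y hy hxy α β hα hβ hαβ => ?_
  have hx' : x < 0 := hx
  have hy' : y < 0 := hy
  have hd : 0 < y - x := sub_pos.2 hxy
  -- This tilt equalizes the values at `x` and `y`, so the maximum principle becomes the chord
  -- inequality.
  set a := -(Real.log (Ψ y) - Real.log (Ψ x)) / (y - x) with ha
  have had : a * (y - x) = -(Real.log (Ψ y) - Real.log (Ψ x)) := div_mul_cancel₀ _ hd.ne'
  have hval : ∀ s < 0, Real.exp (a * s) * Ψ s = Real.exp (a * s + Real.log (Ψ s)) := fun s hs => by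
    rw [Real.exp_add, Real.exp_log (hpos s hs)]
  have hz : α * x + β * y ∈ Icc x y := by
    have : α = 1 - β := by linarith
    subst this
    constructor <;> nlinarith
  have hle := le_of_le_cosAverage (h := fun s => Real.exp (a * s) * Ψ s)
    (M := Real.exp (a * x + Real.log (Ψ x))) hxy.le
    (ContinuousOn.mul (by fun_prop) (hc.mono fun s hs => lt_of_le_of_lt hs.2 hy'))
    (hval x hx').le
    (by
      rw [hval y hy']
      refine Real.exp_le_exp.2 ?_
      linarith)
    (fun s ρ hρ _ h2 => hsub a s ρ hρ (h2.trans_lt hy')) _ hz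
  rw [hval _ (lt_of_le_of_lt hz.2 hy'), Real.exp_le_exp] at hle
  simp only [smul_eq_mul]
  have : α = 1 - β := by linarith
  subst this
  have e : (1 - β) * x + β * y = x + β * (y - x) := by ring
  rw [e] at hle ⊢
  have e2 : a * (x + β * (y - x)) = a * x + β * (a * (y - x)) := by ring
  rw [e2, had] at hle
  linarith

/-- A convex function on the negative half-line that is bounded above near `-∞` is nondecreasing. -/
lemma monotoneOn_of_convexOn_Iio {Φ : ℝ → ℝ} (hΦ : ConvexOn ℝ (Iio (0 : ℝ)) Φ) {C T : ℝ}
    (hC : ∀ t ≤ T, Φ t ≤ C) : MonotoneOn Φ (Iio 0) := by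
  intro x hx y hy hxy
  by_contra! hlt
  have hxy' : x < y := lt_of_le_of_ne hxy (by rintro rfl; exact lt_irrefl _ hlt)
  have hd : 0 < Φ x - Φ y := sub_pos.2 hlt
  have hyx : 0 < y - x := sub_pos.2 hxy'
  set m := (Φ x - Φ y) / (y - x) with hm
  have hm0 : 0 < m := div_pos hd hyx
  -- A descent of slope `-m` after `x` forces `Φ t ≥ Φ x + m (x - t) ≥ C + 1` this far to the left.
  set t := min (min T (x - 1)) (x - (C - Φ x + 1) / m)
  have ht1 : t ≤ T := (min_le_left _ _).trans (min_le_left _ _)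
  have ht2 : t < x := by
    have : t ≤ x - 1 := (min_le_left _ _).trans (min_le_right _ _)
    linarith
  have ht3 : t ≤ x - (C - Φ x + 1) / m := min_le_right _ _
  have hs := hΦ.slope_mono_adjacent (ht2.trans hx) hy ht2 hxy'
  rw [div_le_iff₀ (sub_pos.2 ht2)] at hs
  have e : (Φ y - Φ x) / (y - x) = -m := by rw [hm, ← neg_div, neg_sub]
  rw [e] at hs
  have h4 : (C - Φ x + 1) / m ≤ x - t := by linarith
  rw [div_le_iff₀ hm0] at h4
  have := hC t ht1
  nlinarith

open Real in
/-- Sub-mean value property of `‖h‖ ^ P` for holomorphic `h`. -/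
lemma norm_rpow_le_circleAverage {h : ℂ → ℂ} {c : ℂ} {R P : ℝ} (hR : 0 < R) (hP : 0 < P)
    (hh : AnalyticOnNhd ℂ h (closedBall c |R|)) :
    ‖h c‖ ^ P ≤ circleAverage (fun z => ‖h z‖ ^ P) c R := by
  have hcont : ContinuousOn (fun z => ‖h z‖ ^ P) (sphere c |R|) :=
    ((hh.continuousOn.mono sphere_subset_closedBall).norm).rpow_const fun _ _ => Or.inr hP.le
  rcases eq_or_ne (h c) 0 with h0 | h0
  · rw [h0, norm_zero, zero_rpow hP.ne']
    exact circleAverage_nonneg_of_nonneg fun z _ => by positivity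
  -- Scaling puts the central value at `exp (1 / P)`, the point where `exp 1 * P * log x ≤ x ^ P` is
  -- an equality; the logarithmic sub-mean inequality then transfers to the power without loss.
  set k : ℝ := exp (1 / P) / ‖h c‖ with hk
  have hn : 0 < ‖h c‖ := norm_pos_iff.2 h0
  have hk0 : 0 < k := by positivity
  have hkh : AnalyticOnNhd ℂ (fun z => (k : ℂ) * h z) (closedBall c |R|) :=
    fun z hz => analyticAt_const.mul (hh z hz)
  have hkc : ‖(k : ℂ) * h c‖ = exp (1 / P) := by
    rw [norm_mul, Complex.norm_real, norm_of_nonneg hk0.le, hk]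
    field_simp
  have hlog : 1 / P ≤ circleAverage (fun z => log ‖(k : ℂ) * h z‖) c R := by
    -- Jensen's formula: the zeros in the disc contribute nonnegative terms.
    rw [hkh.circleAverage_log_norm hR.ne' (by simpa using ⟨hk0.ne', h0⟩), hkc, log_exp]
    refine le_add_of_nonneg_left (finsum_nonneg fun u => ?_)
    by_cases hu : u ∈ closedBall c |R|
    · refine mul_nonneg ?_ ?_
      · exact_mod_cast (MeromorphicOn.AnalyticOnNhd.divisor_nonneg hkh) u
      · rcases eq_or_ne ‖c - u‖ 0 with hcu | hcu
        · simp [hcu]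
        · refine log_nonneg ?_
          rw [← div_eq_mul_inv, one_le_div (lt_of_le_of_ne (norm_nonneg _) hcu.symm)]
          rwa [mem_closedBall, dist_comm, dist_eq_norm, abs_of_pos hR] at hu
    · simp [hu]
  have hexp : ∀ x : ℝ, 0 ≤ x → exp 1 * P * log x ≤ x ^ P := fun x hx => by
    rcases eq_or_lt_of_le hx with rfl | hx
    · simp [zero_rpow hP.ne']
    · have h1 := add_one_le_exp (P * log x - 1)
      rw [rpow_def_of_pos hx, mul_comm (log x)]
      have h2 : exp (P * log x) = exp 1 * exp (P * log x - 1) := by rw [← exp_add]; ring_nf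
      rw [h2]
      nlinarith [exp_pos 1]
  have hci : CircleIntegrable (fun z => log ‖(k : ℂ) * h z‖) c R :=
    (hkh.mono sphere_subset_closedBall).meromorphicOn.circleIntegrable_log_norm
  have h1 : circleAverage (fun z => (exp 1 * P) • log ‖(k : ℂ) * h z‖) c R ≤
      circleAverage (fun z => k ^ P • ‖h z‖ ^ P) c R := by
    refine circleAverage_mono (hci.const_mul _) ?_ fun z _ => ?_
    · exact (continuousOn_const.mul hcont).circleIntegrable'
    · have := hexp ‖(k : ℂ) * h z‖ (norm_nonneg _)
      simp only [smul_eq_mul]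
      refine this.trans_eq ?_
      rw [norm_mul, Complex.norm_real, norm_of_nonneg hk0.le, mul_rpow hk0.le (norm_nonneg _)]
  rw [circleAverage_fun_smul, circleAverage_fun_smul, smul_eq_mul, smul_eq_mul] at h1
  have h2 : k ^ P * ‖h c‖ ^ P = exp 1 := by
    rw [← mul_rpow hk0.le hn.le, hk, div_mul_cancel₀ _ hn.ne', ← exp_mul, one_div,
      inv_mul_cancel₀ hP.ne']
  have h3 : exp 1 ≤ exp 1 * P * circleAverage (fun z => log ‖(k : ℂ) * h z‖) c R := by
    have : exp 1 * P * (1 / P) ≤ exp 1 * P * circleAverage (fun z => log ‖(k : ℂ) * h z‖) c R := by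
      gcongr
    rwa [mul_assoc, mul_one_div_cancel hP.ne', mul_one] at this
  rw [← h2] at h3
  exact le_of_mul_le_mul_left ((h3.trans (h2 ▸ le_rfl)).trans h1) (by positivity)

/-! ### The rotation-invariant probability measure on the sphere -/

section SphereMeasure

variable {d : ℕ}

lemma nontrivial_euclideanSpace (i : Fin d) : Nontrivial (EuclideanSpace ℂ (Fin d)) :=
  ⟨EuclideanSpace.single i 1, 0, fun h => by
    simpa using congrArg (fun x : EuclideanSpace ℂ (Fin d) => x i) h⟩

lemma isProbabilityMeasure_sphereMeasure (i : Fin d) :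
    IsProbabilityMeasure (sphereMeasure d) := by
  have := nontrivial_euclideanSpace i
  refine ⟨?_⟩
  rw [sphereMeasure, Measure.smul_apply, smul_eq_mul]
  refine ENNReal.inv_mul_cancel ?_ (measure_ne_top _ _)
  rw [Ne, Measure.measure_univ_eq_zero]
  exact Measure.toSphere_ne_zero _

lemma isOpenPosMeasure_sphereMeasure : (sphereMeasure d).IsOpenPosMeasure :=
  ⟨fun U hU hne => by
    rw [sphereMeasure, Measure.smul_apply, smul_eq_mul]
    exact mul_ne_zero (ENNReal.inv_ne_zero.2 (measure_ne_top _ _)) (hU.measure_ne_zero _ hne)⟩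

/-- Multiplication by a unimodular scalar, as an isometry. -/
noncomputable def unitSMul (d : ℕ) (c : Circle) :
    EuclideanSpace ℂ (Fin d) ≃ₗᵢ[ℝ] EuclideanSpace ℂ (Fin d) where
  toLinearEquiv := (LinearEquiv.smulOfNeZero ℂ _ (c : ℂ) c.coe_ne_zero).restrictScalars ℝ
  norm_map' x := by
    change ‖(c : ℂ) • x‖ = ‖x‖
    rw [norm_smul, Circle.norm_coe, one_mul]

lemma unitSMul_apply (c : Circle) (x : EuclideanSpace ℂ (Fin d)) :
    unitSMul d c x = (c : ℂ) • x := rfl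

/-- Rotation of the sphere by a unimodular scalar. -/
noncomputable def sphereRotation (d : ℕ) (c : Circle) : C(UnitSphere d, UnitSphere d) where
  toFun ζ := ⟨(c : ℂ) • (ζ : EuclideanSpace ℂ (Fin d)), by
    rw [mem_sphere_zero_iff_norm, norm_smul, Circle.norm_coe, one_mul]
    exact norm_eq_of_mem_sphere ζ⟩
  continuous_toFun := by fun_prop

@[simp] lemma coe_sphereRotation (c : Circle) (ζ : UnitSphere d) :
    (sphereRotation d c ζ : EuclideanSpace ℂ (Fin d)) = (c : ℂ) • (ζ : EuclideanSpace ℂ (Fin d)) :=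
  rfl

open scoped Pointwise in
-- The spherical measure of a set is read off from the volume of the cone over it, and the rotation
-- extends to a volume-preserving linear isometry.
lemma measurePreserving_sphereRotation (c : Circle) :
    MeasurePreserving (sphereRotation d c) (sphereMeasure d) (sphereMeasure d) := by
  have hm : Measurable (sphereRotation d c) := (sphereRotation d c).continuous.measurable
  suffices h : Measure.map (sphereRotation d c)
      (volume : Measure (EuclideanSpace ℂ (Fin d))).toSphere =
      (volume : Measure (EuclideanSpace ℂ (Fin d))).toSphere from
    ⟨hm, by rw [sphereMeasure, Measure.map_smul, h]⟩
  ext s hs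
  rw [Measure.map_apply hm hs, Measure.toSphere_apply' _ (hm hs), Measure.toSphere_apply' _ hs]
  congr 1
  rw [← (unitSMul d c).measurePreserving.measure_preimage_emb
    (unitSMul d c).toHomeomorph.measurableEmbedding (Ioo (0 : ℝ) 1 • (Subtype.val '' s))]
  congr 1
  ext x
  simp only [mem_smul, mem_image, mem_preimage, Subtype.exists, unitSMul_apply]
  constructor
  · rintro ⟨r, hr, _, ⟨y, hy, hys, rfl⟩, rfl⟩
    exact ⟨r, hr, _, ⟨_, (sphereRotation d c ⟨y, hy⟩).2, hys, rfl⟩, smul_comm _ _ _⟩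
  · rintro ⟨r, hr, _, ⟨y, hy, hys, rfl⟩, hxy⟩
    refine ⟨r, hr, ((c⁻¹ : Circle) : ℂ) • y, ⟨_, (sphereRotation d c⁻¹ ⟨y, hy⟩).2, ?_, rfl⟩, ?_⟩
    · convert hys using 1
      apply Subtype.ext
      simp [smul_smul]
    · rw [smul_comm, hxy, smul_smul, ← Circle.coe_mul, inv_mul_cancel, Circle.coe_one, one_smul]

end SphereMeasure

/-- A rotation-invariant functional behaving like the `q`-th power of a quasi-norm `L ^ p` on the
continuous functions on the sphere, `q = min p 1`. -/
structure IsQuasiMean {d : ℕ} (i : Fin d) (q : ℝ) (Q : C(UnitSphere d, ℂ) → ℝ) : Prop where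
  exponent_pos : 0 < q
  exponent_le_one : q ≤ 1
  nonneg : ∀ g, 0 ≤ Q g
  add_le : ∀ g h, Q (g + h) ≤ Q g + Q h
  smul : ∀ (c : ℂ) g, Q (c • g) = ‖c‖ ^ q * Q g
  le_norm : ∀ g, Q g ≤ ‖g‖ ^ q
  rotation : ∀ (c : Circle) g, Q (g.comp (sphereRotation d c)) = Q g
  coord_pow : ∀ δ : ℝ, 0 < δ → δ < 1 → ∃ κ, 0 < κ ∧ ∀ (n : ℕ) (g : C(UnitSphere d, ℂ)),
    (∀ ζ : UnitSphere d, g ζ = (ζ : EuclideanSpace ℂ (Fin d)) i ^ n) → κ * δ ^ n ≤ Q g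

/-! ### The sup norm and the power means as quasi-means -/

section Means

variable {d : ℕ}

/-- The point of the sphere on the `i`-th coordinate axis. -/
noncomputable def spherePole (i : Fin d) : UnitSphere d :=
  ⟨EuclideanSpace.single i 1, by simp⟩

lemma spherePole_apply (i : Fin d) : (spherePole i : EuclideanSpace ℂ (Fin d)) i = 1 := by
  simp [spherePole]

lemma isQuasiMean_norm (i : Fin d) : IsQuasiMean i 1 (fun g => ‖g‖) where
  exponent_pos := one_pos
  exponent_le_one := le_rfl
  nonneg g := norm_nonneg g
  add_le g h := norm_add_le g h
  smul c g := by rw [norm_smul, Real.rpow_one]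
  le_norm g := by rw [Real.rpow_one]
  rotation c g := by
    refine le_antisymm ?_ ?_
    · exact (ContinuousMap.norm_le _ (norm_nonneg _)).2 fun ζ => g.norm_coe_le_norm _
    · refine (ContinuousMap.norm_le _ (norm_nonneg _)).2 fun ζ => ?_
      have h := (g.comp (sphereRotation d c)).norm_coe_le_norm (sphereRotation d c⁻¹ ζ)
      rw [ContinuousMap.comp_apply] at h
      convert h using 3
      apply Subtype.ext
      simp [smul_smul]
  coord_pow δ h0 h1 := ⟨1, one_pos, fun n g hg => by
    have h := g.norm_coe_le_norm (spherePole i)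
    rw [hg, spherePole_apply, one_pow, norm_one] at h
    rw [one_mul]
    exact (pow_le_one₀ h0.le h1.le).trans h⟩

/-- The integral of `‖g‖ ^ P` over the sphere. -/
noncomputable def powerMean (P : ℝ) (g : C(UnitSphere d, ℂ)) : ℝ :=
  ∫ ζ, ‖g ζ‖ ^ P ∂(sphereMeasure d)

variable {P : ℝ}

lemma continuous_norm_rpow (hP : 0 < P) (g : C(UnitSphere d, ℂ)) :
    Continuous fun ζ => ‖g ζ‖ ^ P :=
  g.continuous.norm.rpow_const fun _ => Or.inr hP.le

lemma integrable_norm_rpow (i : Fin d) (hP : 0 < P) (g : C(UnitSphere d, ℂ)) :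
    Integrable (fun ζ => ‖g ζ‖ ^ P) (sphereMeasure d) := by
  have := isProbabilityMeasure_sphereMeasure i
  exact (continuous_norm_rpow hP g).integrable_of_hasCompactSupport
    (HasCompactSupport.of_compactSpace _)

lemma powerMean_nonneg (g : C(UnitSphere d, ℂ)) : 0 ≤ powerMean P g :=
  integral_nonneg fun _ => by positivity

lemma powerMean_le_norm (i : Fin d) (hP : 0 < P) (g : C(UnitSphere d, ℂ)) :
    powerMean P g ≤ ‖g‖ ^ P := by
  have := isProbabilityMeasure_sphereMeasure i
  have h := integral_mono (integrable_norm_rpow i hP g) (integrable_const (‖g‖ ^ P))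
    fun ζ => Real.rpow_le_rpow (norm_nonneg _) (g.norm_coe_le_norm ζ) hP.le
  rwa [integral_const, probReal_univ, one_smul] at h

lemma powerMean_smul (c : ℂ) (g : C(UnitSphere d, ℂ)) :
    powerMean P (c • g) = ‖c‖ ^ P * powerMean P g := by
  simp only [powerMean, ContinuousMap.smul_apply, norm_smul]
  simp_rw [Real.mul_rpow (norm_nonneg c) (norm_nonneg _)]
  rw [integral_const_mul]

lemma powerMean_rotation (c : Circle) (g : C(UnitSphere d, ℂ)) :
    powerMean P (g.comp (sphereRotation d c)) = powerMean P g := by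
  have hemb : MeasurableEmbedding (sphereRotation d c) := by
    refine (sphereRotation d c).continuous.measurableEmbedding fun x y hxy => ?_
    have h := congrArg (fun ζ : UnitSphere d => (ζ : EuclideanSpace ℂ (Fin d))) hxy
    simp only [coe_sphereRotation] at h
    exact Subtype.ext (smul_right_injective _ c.coe_ne_zero h)
  exact (measurePreserving_sphereRotation c).integral_comp hemb fun ζ => ‖g ζ‖ ^ P

/-- The cap `|ζ i| > δ` is open and contains the pole; its measure serves as `κ`. -/
lemma exists_le_powerMean_coord (i : Fin d) (hP : 0 < P) {δ : ℝ} (h0 : 0 < δ) (h1 : δ < 1) :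
    ∃ κ, 0 < κ ∧ ∀ (n : ℕ) (g : C(UnitSphere d, ℂ)),
      (∀ ζ : UnitSphere d, g ζ = (ζ : EuclideanSpace ℂ (Fin d)) i ^ n) →
      κ * (δ ^ n) ^ P ≤ powerMean P g := by
  have := isProbabilityMeasure_sphereMeasure i
  have := isOpenPosMeasure_sphereMeasure (d := d)
  set U : Set (UnitSphere d) := {ζ | δ < ‖(ζ : EuclideanSpace ℂ (Fin d)) i‖}
  have hU : IsOpen U := isOpen_lt continuous_const (by fun_prop)
  refine ⟨(sphereMeasure d).real U, ?_, fun n g hg => ?_⟩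
  · refine ENNReal.toReal_pos (hU.measure_ne_zero _ ⟨spherePole i, ?_⟩) (measure_ne_top _ _)
    simp only [U, mem_ofPred_eq, spherePole_apply, norm_one, h1]
  · rw [← smul_eq_mul, ← integral_indicator_const _ hU.measurableSet]
    refine integral_mono ((integrable_const _).indicator hU.measurableSet)
      (integrable_norm_rpow i hP g) fun ζ => ?_
    by_cases hζ : ζ ∈ U
    · rw [indicator_of_mem hζ]
      refine Real.rpow_le_rpow (by positivity) ?_ hP.le
      rw [hg, norm_pow]
      have : δ < ‖(ζ : EuclideanSpace ℂ (Fin d)) i‖ := hζ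
      gcongr
    · rw [indicator_of_notMem hζ]
      positivity

/-- For `P ≤ 1` no root is taken: `(a + b) ^ P ≤ a ^ P + b ^ P` makes the integral itself
subadditive. -/
lemma isQuasiMean_powerMean (i : Fin d) (hP : 0 < P) (hP1 : P ≤ 1) :
    IsQuasiMean i P (powerMean P) where
  exponent_pos := hP
  exponent_le_one := hP1
  nonneg := powerMean_nonneg
  add_le g h := by
    simp only [powerMean]
    rw [← integral_add (integrable_norm_rpow i hP g) (integrable_norm_rpow i hP h)]
    refine integral_mono (integrable_norm_rpow i hP (g + h))
      ((integrable_norm_rpow i hP g).add (integrable_norm_rpow i hP h)) fun ζ => ?_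
    exact (Real.rpow_le_rpow (norm_nonneg _) (norm_add_le (g ζ) (h ζ)) hP.le).trans
      (Real.rpow_add_le_add_rpow (norm_nonneg _) (norm_nonneg _) hP.le hP1)
  smul := powerMean_smul
  le_norm := powerMean_le_norm i hP
  rotation := powerMean_rotation
  coord_pow δ h0 h1 := by
    obtain ⟨κ, hκ, h⟩ := exists_le_powerMean_coord i hP h0 h1
    refine ⟨κ, hκ, fun n g hg => le_trans ?_ (h n g hg)⟩
    gcongr
    have h2 : δ ^ n ≤ 1 := pow_le_one₀ h0.le h1.le
    calc δ ^ n = (δ ^ n) ^ (1 : ℝ) := (Real.rpow_one _).symm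
      _ ≤ (δ ^ n) ^ P := Real.rpow_le_rpow_of_exponent_ge (by positivity) h2 hP1

lemma powerMean_rpow_add_le (i : Fin d) (hP1 : 1 ≤ P) (g h : C(UnitSphere d, ℂ)) :
    powerMean P (g + h) ^ (1 / P) ≤ powerMean P g ^ (1 / P) + powerMean P h ^ (1 / P) := by
  have := isProbabilityMeasure_sphereMeasure i
  have hP : 0 < P := one_pos.trans_le hP1
  have hmem : ∀ g : C(UnitSphere d, ℂ), MemLp g (ENNReal.ofReal P) (sphereMeasure d) := fun g =>
    MemLp.of_bound g.continuous.aestronglyMeasurable ‖g‖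
      (Filter.Eventually.of_forall g.norm_coe_le_norm)
  have hp0 : ENNReal.ofReal P ≠ 0 := by simpa using hP
  have heq : ∀ g : C(UnitSphere d, ℂ), eLpNorm g (ENNReal.ofReal P) (sphereMeasure d) =
      ENNReal.ofReal (powerMean P g ^ (1 / P)) := fun g => by
    rw [(hmem g).eLpNorm_eq_integral_rpow_norm hp0 ENNReal.ofReal_ne_top,
      ENNReal.toReal_ofReal hP.le, one_div]
    rfl
  have hnn : ∀ g : C(UnitSphere d, ℂ), 0 ≤ powerMean P g ^ (1 / P) := fun g =>
    Real.rpow_nonneg (powerMean_nonneg g) _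
  have key := eLpNorm_add_le (hmem g).1 (hmem h).1
    (by rw [ENNReal.one_le_ofReal]; exact hP1 : (1 : ℝ≥0∞) ≤ ENNReal.ofReal P)
  rw [heq g, heq h, ← ContinuousMap.coe_add, heq, ← ENNReal.ofReal_add (hnn _) (hnn _),
    ENNReal.ofReal_le_ofReal_iff (add_nonneg (hnn _) (hnn _))] at key
  exact key

lemma isQuasiMean_powerMean_rpow (i : Fin d) (hP1 : 1 ≤ P) :
    IsQuasiMean i 1 (fun g => powerMean P g ^ (1 / P)) := by
  have hP : 0 < P := one_pos.trans_le hP1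
  have hroot : ∀ x : ℝ, 0 ≤ x → (x ^ P) ^ (1 / P) = x := fun x hx => by
    rw [← Real.rpow_mul hx, mul_one_div_cancel hP.ne', Real.rpow_one]
  exact {
    exponent_pos := one_pos
    exponent_le_one := le_rfl
    nonneg := fun g => Real.rpow_nonneg (powerMean_nonneg g) _
    add_le := powerMean_rpow_add_le i hP1
    smul := fun c g => by
      rw [powerMean_smul, Real.mul_rpow (by positivity) (powerMean_nonneg g),
        hroot _ (norm_nonneg c), Real.rpow_one]
    le_norm := fun g => by
      rw [Real.rpow_one, ← hroot _ (norm_nonneg g)]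
      exact Real.rpow_le_rpow (powerMean_nonneg g) (powerMean_le_norm i hP g) (by positivity)
    rotation := fun c g => by rw [powerMean_rotation]
    coord_pow := fun δ h0 h1 => by
      obtain ⟨κ, hκ, h⟩ := exists_le_powerMean_coord i hP h0 h1
      refine ⟨κ ^ (1 / P), by positivity, fun n g hg => ?_⟩
      rw [← hroot (δ ^ n) (by positivity), ← Real.mul_rpow hκ.le (by positivity)]
      exact Real.rpow_le_rpow (by positivity) (h n g hg) (by positivity) }

lemma integralMean_eq_powerMean {p : ℝ≥0∞} (hp : p ≠ ∞) {f : EuclideanSpace ℂ (Fin d) → ℂ} {r : ℝ}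
    {g : C(UnitSphere d, ℂ)}
    (hg : ∀ ζ : UnitSphere d, g ζ = f (r • (ζ : EuclideanSpace ℂ (Fin d)))) :
    integralMean p f r = powerMean p.toReal g ^ (1 / p.toReal) := by
  simp only [integralMean, if_neg hp, powerMean, hg]

lemma integralMean_top_eq_norm (i : Fin d) {f : EuclideanSpace ℂ (Fin d) → ℂ} {r : ℝ} (hr : 0 ≤ r)
    {g : C(UnitSphere d, ℂ)}
    (hg : ∀ ζ : UnitSphere d, g ζ = f (r • (ζ : EuclideanSpace ℂ (Fin d)))) :
    integralMean ∞ f r = ‖g‖ := by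
  have : Nonempty (UnitSphere d) := ⟨spherePole i⟩
  rw [integralMean, if_pos rfl, g.norm_eq_iSup_norm, iSup]
  congr 1
  ext y
  simp only [mem_image, mem_ofPred_eq, mem_range, hg]
  constructor
  · rintro ⟨z, hz, rfl⟩
    -- At `r = 0` the set `‖z‖ = r` is one point and the slice is constant, so any point of the
    -- sphere serves.
    rcases eq_or_lt_of_le hr with rfl | h
    · refine ⟨spherePole i, ?_⟩
      rw [norm_eq_zero.1 hz, zero_smul]
    · refine ⟨⟨r⁻¹ • z, ?_⟩, ?_⟩
      · rw [mem_sphere_zero_iff_norm, norm_smul, hz, norm_inv, Real.norm_of_nonneg hr,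
          inv_mul_cancel₀ h.ne']
      · simp only [smul_smul, mul_inv_cancel₀ h.ne', one_smul]
  · rintro ⟨ζ, rfl⟩
    exact ⟨_, by rw [norm_smul, norm_eq_of_mem_sphere ζ, mul_one, Real.norm_of_nonneg hr], rfl⟩

/-- Every integral mean is a power of a quasi-mean. -/
lemma exists_isQuasiMean (i : Fin d) {p : ℝ≥0∞} (hp : 0 < p) :
    ∃ (q : ℝ) (Q : C(UnitSphere d, ℂ) → ℝ), IsQuasiMean i q Q ∧
      ∀ (f : EuclideanSpace ℂ (Fin d) → ℂ) (r : ℝ) (g : C(UnitSphere d, ℂ)), 0 ≤ r →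
        (∀ ζ : UnitSphere d, g ζ = f (r • (ζ : EuclideanSpace ℂ (Fin d)))) →
        integralMean p f r = Q g ^ (1 / q) := by
  rcases eq_or_ne p ∞ with rfl | hp'
  · refine ⟨1, _, isQuasiMean_norm i, fun f r g hr hg => ?_⟩
    rw [integralMean_top_eq_norm i hr hg, div_one, Real.rpow_one]
  · have hP : 0 < p.toReal := ENNReal.toReal_pos hp.ne' hp'
    rcases le_total p.toReal 1 with h | h
    · exact ⟨_, _, isQuasiMean_powerMean i hP h, fun f r g _ hg => integralMean_eq_powerMean hp' hg⟩
    · refine ⟨1, _, isQuasiMean_powerMean_rpow i h, fun f r g _ hg => ?_⟩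
      rw [integralMean_eq_powerMean hp' hg, div_one, Real.rpow_one]

end Means

/-! ### Integral means of a holomorphic function are log-convex weights -/

section Slices

variable {d : ℕ}

/-- Subadditivity and `le_norm` give the Hölder bound `|Q g - Q h| ≤ ‖g - h‖ ^ q`. -/
lemma IsQuasiMean.continuous {i : Fin d} {q : ℝ} {Q : C(UnitSphere d, ℂ) → ℝ}
    (hQ : IsQuasiMean i q Q) : Continuous Q := by
  have hle : ∀ g h, |Q g - Q h| ≤ ‖g - h‖ ^ q := fun g h => by
    have h1 := hQ.add_le (g - h) h
    have h2 := hQ.add_le (h - g) g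
    have h3 := hQ.le_norm (g - h)
    have h4 := hQ.le_norm (h - g)
    rw [sub_add_cancel] at h1 h2
    rw [norm_sub_rev] at h4
    rw [abs_le]
    constructor <;> linarith
  rw [continuous_iff_continuousAt]
  intro g
  rw [ContinuousAt, tendsto_iff_norm_sub_tendsto_zero]
  refine squeeze_zero (fun _ => norm_nonneg _) (fun h => hle h g) ?_
  have hc : Continuous fun h : C(UnitSphere d, ℂ) => ‖h - g‖ ^ q :=
    (by fun_prop : Continuous fun h : C(UnitSphere d, ℂ) => ‖h - g‖).rpow_const
      fun _ => Or.inr hQ.exponent_pos.le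
  have := hc.tendsto g
  rwa [sub_self, norm_zero, Real.zero_rpow hQ.exponent_pos.ne'] at this

lemma smul_mem_unitBall {r : ℝ} (hr : r ∈ Ico (0 : ℝ) 1) (ζ : UnitSphere d) :
    r • (ζ : EuclideanSpace ℂ (Fin d)) ∈ ball (0 : EuclideanSpace ℂ (Fin d)) 1 := by
  rw [mem_ball_zero_iff, norm_smul, norm_eq_of_mem_sphere ζ, mul_one, Real.norm_of_nonneg hr.1]
  exact hr.2

/-- The dilations `ζ ↦ f (r ζ)`, as a continuous family of continuous functions on the sphere. -/
noncomputable def slice {f : EuclideanSpace ℂ (Fin d) → ℂ} (hf : ContinuousOn f (ball 0 1)) :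
    C(Ico (0 : ℝ) 1, C(UnitSphere d, ℂ)) :=
  ContinuousMap.curry ⟨fun x => f ((x.1 : ℝ) • (x.2 : EuclideanSpace ℂ (Fin d))),
    hf.comp_continuous (by fun_prop) fun x => smul_mem_unitBall x.1.2 x.2⟩

variable {f : EuclideanSpace ℂ (Fin d) → ℂ}

lemma slice_apply (hf : ContinuousOn f (ball 0 1)) (r : Ico (0 : ℝ) 1) (ζ : UnitSphere d) :
    slice hf r ζ = f ((r : ℝ) • (ζ : EuclideanSpace ℂ (Fin d))) := rfl

lemma continuousOn_integralMean (i : Fin d) {p : ℝ≥0∞} (hp : 0 < p)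
    (hf : ContinuousOn f (ball 0 1)) : ContinuousOn (integralMean p f) (Ico 0 1) := by
  obtain ⟨q, Q, hQ, h⟩ := exists_isQuasiMean i hp
  rw [continuousOn_iff_continuous_domRestrict]
  have e : (Ico (0 : ℝ) 1).domRestrict (integralMean p f) = fun r => Q (slice hf r) ^ (1 / q) := by
    funext r
    exact h f r _ r.2.1 fun ζ => slice_apply hf r ζ
  rw [e]
  exact (hQ.continuous.comp (slice hf).continuous).rpow_const
    fun _ => Or.inr (one_div_pos.2 hQ.exponent_pos).le

lemma exp_mem_Ico {s : ℝ} (hs : s < 0) : Real.exp s ∈ Ico (0 : ℝ) 1 :=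
  ⟨(Real.exp_pos s).le, by rw [← Real.exp_zero]; exact Real.exp_lt_exp.2 hs⟩

lemma add_mul_cos_lt {s ρ : ℝ} (hρ : 0 < ρ) (hs : s + ρ < 0) (t : ℝ) :
    s + ρ * Real.cos t < 0 := by
  nlinarith [Real.cos_le_one t]

/-- Sub-mean value property on the disc of centre `s` and radius `ρ` in the logarithmic variable:
the real part of a boundary point gives the radius in the ball, the imaginary part a rotation of
`ζ`. -/
lemma rotated_le_cosAverage {P : ℝ} (hP : 0 < P) (hf : IsHolomorphicOnBall d f)
    (ζ : UnitSphere d) (a s ρ : ℝ) (hρ : 0 < ρ) (hs : s + ρ < 0) :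
    2 * Real.pi * (Real.exp (a * s) *
        ‖f (Real.exp s • (ζ : EuclideanSpace ℂ (Fin d)))‖ ^ P) ≤
      ∫ t in (0 : ℝ)..2 * Real.pi, Real.exp (a * (s + ρ * Real.cos t)) *
        ‖f (Real.exp (s + ρ * Real.cos t) •
          (sphereRotation d (Circle.exp (ρ * Real.sin t)) ζ : EuclideanSpace ℂ (Fin d)))‖ ^ P := by
  set h : ℂ → ℂ := fun z => Complex.exp ((a / P : ℝ) * z) *
    f (Complex.exp z • (ζ : EuclideanSpace ℂ (Fin d)))
  have hdiff : DifferentiableOn ℂ h {z | z.re < 0} := by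
    refine DifferentiableOn.mul (by fun_prop) ?_
    refine DifferentiableOn.comp (t := ball 0 1) hf (by fun_prop) fun z hz => ?_
    have hz' : z.re < 0 := hz
    rw [mem_ball_zero_iff, norm_smul, norm_eq_of_mem_sphere ζ, mul_one, Complex.norm_exp]
    exact (exp_mem_Ico hz').2
  have hana : AnalyticOnNhd ℂ h (closedBall (s : ℂ) |ρ|) := by
    refine (hdiff.analyticOnNhd (isOpen_lt Complex.continuous_re continuous_const)).mono
      fun z hz => ?_
    rw [abs_of_pos hρ, mem_closedBall, dist_eq_norm] at hz
    have h1 := (Complex.re_le_norm (z - s)).trans hz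
    rw [Complex.sub_re, Complex.ofReal_re] at h1
    show z.re < 0
    linarith
  have hnorm : ∀ z, ‖h z‖ ^ P = Real.exp (a * z.re) *
      ‖f (Complex.exp z • (ζ : EuclideanSpace ℂ (Fin d)))‖ ^ P := fun z => by
    rw [norm_mul, Real.mul_rpow (norm_nonneg _) (norm_nonneg _), Complex.norm_exp,
      Complex.re_ofReal_mul, ← Real.exp_mul]
    congr 2
    field_simp
  have hcs : Complex.exp (s : ℂ) • (ζ : EuclideanSpace ℂ (Fin d)) =
      Real.exp s • (ζ : EuclideanSpace ℂ (Fin d)) := by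
    rw [← Complex.ofReal_exp, Complex.coe_smul]
  have key := norm_rpow_le_circleAverage hρ hP hana
  rw [Real.circleAverage_def, smul_eq_mul, le_inv_mul_iff₀ (by positivity), hnorm, hcs,
    Complex.ofReal_re] at key
  refine key.trans_eq (intervalIntegral.integral_congr fun t _ => ?_)
  have hre : (circleMap (s : ℂ) ρ t).re = s + ρ * Real.cos t := by
    simp [circleMap, Complex.exp_ofReal_mul_I_re]
  have hexp : Complex.exp (circleMap (s : ℂ) ρ t) =
      (Real.exp (s + ρ * Real.cos t) : ℂ) * Circle.exp (ρ * Real.sin t) := by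
    rw [Circle.coe_exp, Complex.ofReal_exp, ← Complex.exp_add]
    congr 1
    rw [circleMap, Complex.exp_mul_I]
    push_cast
    ring
  rw [hnorm, hre, hexp, mul_smul, Complex.coe_smul, coe_sphereRotation]

lemma continuous_rotated {P : ℝ} (hP : 0 < P) (hf : ContinuousOn f (ball 0 1)) (a s ρ : ℝ)
    (hρ : 0 < ρ) (hs : s + ρ < 0) :
    Continuous fun x : ℝ × UnitSphere d => Real.exp (a * (s + ρ * Real.cos x.1)) *
        ‖f (Real.exp (s + ρ * Real.cos x.1) •
          (sphereRotation d (Circle.exp (ρ * Real.sin x.1)) x.2 :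
            EuclideanSpace ℂ (Fin d)))‖ ^ P := by
  refine Continuous.mul (by fun_prop) ?_
  refine Continuous.rpow_const (Continuous.norm ?_) fun _ => Or.inr hP.le
  refine hf.comp_continuous ?_ fun x => smul_mem_unitBall (exp_mem_Ico (add_mul_cos_lt hρ hs _)) _
  simp only [coe_sphereRotation]
  fun_prop

lemma continuous_slice_cos (hf : ContinuousOn f (ball 0 1)) {s ρ : ℝ} (hρ : 0 < ρ)
    (hs : s + ρ < 0) : Continuous fun t : ℝ => slice hf
      ⟨Real.exp (s + ρ * Real.cos t), exp_mem_Ico (add_mul_cos_lt hρ hs t)⟩ :=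
  (slice hf).continuous.comp (by fun_prop)

/-- Integrate the pointwise inequality over the sphere; after Fubini, rotation invariance erases the
angle `ρ sin t`. -/
lemma powerMean_le_cosAverage (i : Fin d) {P : ℝ} (hP : 0 < P) (hf : IsHolomorphicOnBall d f)
    (a s ρ : ℝ) (hρ : 0 < ρ) (hs : s + ρ < 0) :
    2 * Real.pi * (Real.exp (a * s) *
        powerMean P (slice hf.continuousOn ⟨Real.exp s, exp_mem_Ico (by linarith)⟩)) ≤
      ∫ t in (0 : ℝ)..2 * Real.pi, Real.exp (a * (s + ρ * Real.cos t)) *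
        powerMean P (slice hf.continuousOn
          ⟨Real.exp (s + ρ * Real.cos t), exp_mem_Ico (add_mul_cos_lt hρ hs t)⟩) := by
  have := isProbabilityMeasure_sphereMeasure i
  have hc := continuous_rotated hP hf.continuousOn a s ρ hρ hs
  set G : ℝ → UnitSphere d → ℝ := fun t ζ => Real.exp (a * (s + ρ * Real.cos t)) *
        ‖f (Real.exp (s + ρ * Real.cos t) •
          (sphereRotation d (Circle.exp (ρ * Real.sin t)) ζ :
            EuclideanSpace ℂ (Fin d)))‖ ^ P with hG
  have hint : Integrable (Function.uncurry G)
      ((volume.restrict (uIoc 0 (2 * Real.pi))).prod (sphereMeasure d)) := by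
    rw [uIoc_of_le (by positivity)]
    obtain ⟨C, hC⟩ := (isCompact_Icc (a := (0 : ℝ)) (b := 2 * Real.pi)).prod
      (isCompact_univ (X := UnitSphere d)) |>.exists_bound_of_continuousOn
      (f := Function.uncurry G) hc.continuousOn
    refine Integrable.of_bound hc.aestronglyMeasurable C ?_
    filter_upwards [(Measure.quasiMeasurePreserving_fst
      (μ := volume.restrict (Ioc (0 : ℝ) (2 * Real.pi))) (ν := sphereMeasure d)).ae
      (ae_restrict_mem measurableSet_Ioc)] with x hx
    exact hC x ⟨Ioc_subset_Icc_self hx, mem_univ _⟩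
  have hswap := intervalIntegral_integral_swap hint
  have hinner : ∀ t, ∫ ζ, G t ζ ∂(sphereMeasure d) = Real.exp (a * (s + ρ * Real.cos t)) *
      powerMean P (slice hf.continuousOn
          ⟨Real.exp (s + ρ * Real.cos t), exp_mem_Ico (add_mul_cos_lt hρ hs t)⟩) := fun t => by
    rw [← powerMean_rotation (Circle.exp (ρ * Real.sin t)), powerMean, ← integral_const_mul]
    rfl
  simp_rw [hinner] at hswap
  rw [hswap, powerMean, ← integral_const_mul, ← integral_const_mul]
  refine integral_mono (((integrable_norm_rpow i hP _).const_mul _).const_mul _) ?_ fun ζ =>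
    rotated_le_cosAverage hP hf ζ a s ρ hρ hs
  have := hint.integral_prod_right
  simp only [intervalIntegral.integral_of_le (mul_pos two_pos Real.pi_pos).le,
    uIoc_of_le (mul_pos two_pos Real.pi_pos).le] at this ⊢
  exact this

/-- Use the pointwise inequality with exponent `1` at a `ζ` where the slice attains its norm. -/
lemma norm_slice_le_cosAverage (i : Fin d) (hf : IsHolomorphicOnBall d f)
    (a s ρ : ℝ) (hρ : 0 < ρ) (hs : s + ρ < 0) :
    2 * Real.pi * (Real.exp (a * s) *
        ‖slice hf.continuousOn ⟨Real.exp s, exp_mem_Ico (by linarith)⟩‖) ≤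
      ∫ t in (0 : ℝ)..2 * Real.pi, Real.exp (a * (s + ρ * Real.cos t)) *
        ‖slice hf.continuousOn
          ⟨Real.exp (s + ρ * Real.cos t), exp_mem_Ico (add_mul_cos_lt hρ hs t)⟩‖ := by
  set g := slice hf.continuousOn ⟨Real.exp s, exp_mem_Ico (by linarith)⟩
  obtain ⟨ζ, -, hζ⟩ := isCompact_univ.exists_isMaxOn ⟨spherePole i, mem_univ _⟩
    (g.continuous.norm.continuousOn (s := univ))
  have hg : ‖g‖ ≤ ‖g ζ‖ := (g.norm_le (norm_nonneg _)).2 fun ξ => hζ (mem_univ ξ)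
  have h1 := rotated_le_cosAverage one_pos hf ζ a s ρ hρ hs
  simp only [Real.rpow_one] at h1
  calc _ ≤ 2 * Real.pi * (Real.exp (a * s) * ‖g ζ‖) := by gcongr
    _ ≤ _ := h1
    _ ≤ _ := by
      refine intervalIntegral.integral_mono_on (by positivity) ?_ ?_ fun t _ => ?_
      · have hc := (continuous_rotated one_pos hf.continuousOn a s ρ hρ hs).comp
          (Continuous.prodMk_left ζ)
        simp only [Real.rpow_one] at hc
        exact hc.intervalIntegrable _ _
      · refine Continuous.intervalIntegrable ?_ _ _
        exact Continuous.mul (by fun_prop) (continuous_slice_cos hf.continuousOn hρ hs).norm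
      · gcongr
        exact (slice hf.continuousOn ⟨Real.exp (s + ρ * Real.cos t),
          exp_mem_Ico (add_mul_cos_lt hρ hs t)⟩).norm_coe_le_norm _

/-- **Hardy's convexity theorem** on the ball. -/
lemma convexOn_log_integralMean (i : Fin d) {p : ℝ≥0∞} (hp : 0 < p) (hf : IsHolomorphicOnBall d f)
    (hpos : ∀ r ∈ Ico (0 : ℝ) 1, 0 < integralMean p f r) :
    ConvexOn ℝ (Iio (0 : ℝ)) fun t => Real.log (integralMean p f (Real.exp t)) := by
  have hcM : ContinuousOn (fun t => integralMean p f (Real.exp t)) (Iio 0) :=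
    (continuousOn_integralMean i hp hf.continuousOn).comp (by fun_prop)
      fun s hs => exp_mem_Ico hs
  rcases eq_or_ne p ∞ with rfl | hp'
  · have hM : ∀ s (hs : s < 0), integralMean ∞ f (Real.exp s) =
        ‖slice hf.continuousOn ⟨Real.exp s, exp_mem_Ico hs⟩‖ := fun s hs =>
      integralMean_top_eq_norm i (Real.exp_pos s).le fun ζ => slice_apply _ _ ζ
    refine convexOn_log_of_le_cosAverage hcM (fun s hs => hpos _ (exp_mem_Ico hs))
      fun a s ρ hρ hs => ?_
    have := norm_slice_le_cosAverage i hf a s ρ hρ hs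
    rw [hM s (by linarith)]
    refine this.trans_eq (intervalIntegral.integral_congr fun t _ => ?_)
    rw [hM _ (add_mul_cos_lt hρ hs t)]
  · have hP : 0 < p.toReal := ENNReal.toReal_pos hp.ne' hp'
    have hM : ∀ s (hs : s < 0), powerMean p.toReal
        (slice hf.continuousOn ⟨Real.exp s, exp_mem_Ico hs⟩) =
          integralMean p f (Real.exp s) ^ p.toReal := fun s hs => by
      rw [integralMean_eq_powerMean hp' fun ζ => slice_apply hf.continuousOn ⟨Real.exp s, exp_mem_Ico hs⟩ ζ,
        ← Real.rpow_mul (powerMean_nonneg _), one_div_mul_cancel hP.ne', Real.rpow_one]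
    have key : ConvexOn ℝ (Iio (0 : ℝ))
        fun t => Real.log (integralMean p f (Real.exp t) ^ p.toReal) := by
      refine convexOn_log_of_le_cosAverage (hcM.rpow_const fun _ _ => Or.inr hP.le)
        (fun s hs => Real.rpow_pos_of_pos (hpos _ (exp_mem_Ico hs)) _) fun a s ρ hρ hs => ?_
      have := powerMean_le_cosAverage i hP hf a s ρ hρ hs
      rw [← hM s (by linarith)]
      refine this.trans_eq (intervalIntegral.integral_congr fun t _ => ?_)
      rw [← hM _ (add_mul_cos_lt hρ hs t)]
    refine (key.smul (inv_pos.2 hP).le).congr fun t ht => ?_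
    simp only [smul_eq_mul]
    rw [Real.log_rpow (hpos _ (exp_mem_Ico ht)), inv_mul_cancel_left₀ hP.ne']

/-- Monotonicity follows from convexity, since continuity on `[0, 1 / 2]` bounds the logarithm above
near `-∞`; the endpoint `0` is added by a limit. -/
lemma isLogConvexWeight_integralMean (i : Fin d) {p : ℝ≥0∞} (hp : 0 < p)
    (hf : IsHolomorphicOnBall d f) (hpos : ∀ r ∈ Ico (0 : ℝ) 1, 0 < integralMean p f r) :
    IsLogConvexWeight (integralMean p f) := by
  have hc := continuousOn_integralMean i hp hf.continuousOn
  have hconv := convexOn_log_integralMean i hp hf hpos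
  have hIoo : MonotoneOn (integralMean p f) (Ioo 0 1) := by
    obtain ⟨C, hC⟩ := isCompact_Icc.exists_bound_of_continuousOn
      (hc.mono (Icc_subset_Ico_right (by norm_num : (1 / 2 : ℝ) < 1)))
    have hmono := monotoneOn_of_convexOn_Iio hconv (C := Real.log C) (T := Real.log (1 / 2))
      fun t ht => by
        have h1 : Real.exp t ≤ 1 / 2 := by
          rw [← Real.exp_log (by norm_num : (0 : ℝ) < 1 / 2)]
          exact Real.exp_le_exp.2 ht
        have h2 : Real.exp t ∈ Ico (0 : ℝ) 1 := ⟨(Real.exp_pos t).le, by linarith⟩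
        exact Real.log_le_log (hpos _ h2)
          ((le_abs_self _).trans (hC _ ⟨(Real.exp_pos t).le, h1⟩))
    intro x hx y hy hxy
    have h := hmono (Real.log_neg hx.1 hx.2) (Real.log_neg hy.1 hy.2) (Real.log_le_log hx.1 hxy)
    simp only [Real.exp_log hx.1, Real.exp_log hy.1] at h
    exact (Real.log_le_log_iff (hpos x ⟨hx.1.le, hx.2⟩) (hpos y ⟨hy.1.le, hy.2⟩)).1 h
  refine ⟨⟨hpos, hc, ?_⟩, hconv⟩
  intro x hx y hy hxy
  rcases eq_or_lt_of_le hx.1 with rfl | hx0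
  · rcases eq_or_lt_of_le hy.1 with rfl | hy0
    · exact le_rfl
    · have ht : Filter.Tendsto (integralMean p f) (nhdsWithin 0 (Ioo 0 1))
          (nhds (integralMean p f 0)) :=
        (hc 0 hx).mono_left (nhdsWithin_mono _ Ioo_subset_Ico_self)
      have hne : (nhdsWithin (0 : ℝ) (Ioo 0 1)).NeBot := by
        rw [nhdsWithin_Ioo_eq_nhdsGT one_pos]; infer_instance
      refine le_of_tendsto ht ?_
      filter_upwards [self_mem_nhdsWithin, nhdsWithin_le_nhds (Iio_mem_nhds hy0)] with r hr hry
      exact hIoo hr ⟨hy0, hy.2⟩ (le_of_lt hry)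
  · exact hIoo ⟨hx0, hx.2⟩ ⟨hx0.trans_le hxy, hy.2⟩ hxy

end Slices

/-! ### Lacunary series with prescribed integral means -/

section Lacunary

variable {d : ℕ}

/-- The monomial `ζ i ^ n` on the sphere. -/
noncomputable def coordPow (i : Fin d) (n : ℕ) : C(UnitSphere d, ℂ) :=
  ⟨fun ζ => (ζ : EuclideanSpace ℂ (Fin d)) i ^ n, by fun_prop⟩

lemma coordPow_apply (i : Fin d) (n : ℕ) (ζ : UnitSphere d) :
    coordPow i n ζ = (ζ : EuclideanSpace ℂ (Fin d)) i ^ n := rfl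

lemma norm_coordPow_le (i : Fin d) (n : ℕ) : ‖coordPow i n‖ ≤ 1 := by
  refine (ContinuousMap.norm_le _ zero_le_one).2 fun ζ => ?_
  rw [coordPow_apply, norm_pow]
  refine pow_le_one₀ (norm_nonneg _) ?_
  exact (PiLp.norm_apply_le (ζ : EuclideanSpace ℂ (Fin d)) i).trans_eq (norm_eq_of_mem_sphere ζ)

namespace IsQuasiMean

variable {i : Fin d} {q : ℝ} {Q : C(UnitSphere d, ℂ) → ℝ} (hQ : IsQuasiMean i q Q)
include hQ

lemma smul_of_norm_one {c : ℂ} (hc : ‖c‖ = 1) (g : C(UnitSphere d, ℂ)) : Q (c • g) = Q g := by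
  rw [hQ.smul, hc, Real.one_rpow, one_mul]

lemma neg (g : C(UnitSphere d, ℂ)) : Q (-g) = Q g := by
  rw [← neg_one_smul ℂ g]
  exact hQ.smul_of_norm_one (by simp) g

lemma zero : Q 0 = 0 := by
  have h := hQ.smul 0 0
  have e : (0 : ℂ) • (0 : C(UnitSphere d, ℂ)) = 0 := by ext; simp
  rwa [e, norm_zero, Real.zero_rpow hQ.exponent_pos.ne', zero_mul] at h

/-- Write `2 x` and `2 y` as the sum and difference of `x + y` and `x - y`; doubling does not
decrease `Q`. -/
lemma le_two_mul_of_sub_eq {x y : C(UnitSphere d, ℂ)} (h : Q (x - y) = Q (x + y)) :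
    Q x ≤ 2 * Q (x + y) ∧ Q y ≤ 2 * Q (x + y) := by
  have key : ∀ z, Q z ≤ Q ((2 : ℂ) • z) := fun z => by
    rw [hQ.smul]
    refine le_mul_of_one_le_left (hQ.nonneg z) (Real.one_le_rpow ?_ hQ.exponent_pos.le)
    norm_num
  have hx : (2 : ℂ) • x = (x + y) + (x - y) := by
    ext
    simp only [ContinuousMap.smul_apply, ContinuousMap.add_apply,
      ContinuousMap.sub_apply, smul_eq_mul]
    ring
  have hy : (2 : ℂ) • y = (x + y) + -(x - y) := by
    ext
    simp only [ContinuousMap.smul_apply, ContinuousMap.add_apply, ContinuousMap.neg_apply,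
      ContinuousMap.sub_apply, smul_eq_mul]
    ring
  have h1 := hQ.add_le (x + y) (x - y)
  have h2 := hQ.add_le (x + y) (-(x - y))
  rw [hQ.neg] at h2
  rw [← hx, h] at h1
  rw [← hy, h] at h2
  constructor
  · linarith [key x]
  · linarith [key y]

/-- A two-term lacunary polynomial dominates each of its terms in mean. -/
lemma le_two_mul_add {m n : ℕ} (hmn : m < n) (A B : ℂ) :
    Q (A • coordPow i m) ≤ 2 * Q (A • coordPow i m + B • coordPow i n) ∧
      Q (B • coordPow i n) ≤ 2 * Q (A • coordPow i m + B • coordPow i n) := by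
  refine hQ.le_two_mul_of_sub_eq ?_
  have hd : ((n - m : ℕ) : ℝ) ≠ 0 := by
    have : 0 < n - m := Nat.sub_pos_of_lt hmn
    positivity
  -- Since `c ^ (n - m) = -1`, rotation by `c` turns `x + y` into `c ^ m • (x - y)`.
  set c := Circle.exp (Real.pi / (n - m : ℕ))
  have hc : (c : ℂ) ^ (n - m) = -1 := by
    rw [Circle.coe_exp, ← Complex.exp_nat_mul]
    convert Complex.exp_pi_mul_I using 2
    have : ((n - m : ℕ) : ℂ) ≠ 0 := by exact_mod_cast hd
    push_cast
    field_simp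
  rw [← hQ.rotation c (A • coordPow i m + B • coordPow i n),
    ← hQ.smul_of_norm_one (c := (c : ℂ) ^ m) (by rw [norm_pow, Circle.norm_coe, one_pow])]
  congr 1
  ext ζ
  have hn : (c : ℂ) ^ n = (c : ℂ) ^ m * -1 := by
    rw [← hc, ← pow_add, Nat.add_sub_cancel' hmn.le]
  simp only [ContinuousMap.smul_apply, ContinuousMap.sub_apply, ContinuousMap.comp_apply,
    ContinuousMap.add_apply, coordPow_apply, coe_sphereRotation, PiLp.smul_apply, smul_eq_mul,
    mul_pow, hn]
  ring

lemma sum_le (G : ℕ → C(UnitSphere d, ℂ)) (n : ℕ) :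
    Q (∑ j ∈ Finset.range n, G j) ≤ ∑ j ∈ Finset.range n, Q (G j) := by
  induction n with
  | zero => simp [hQ.zero]
  | succ n ih =>
    rw [Finset.sum_range_succ, Finset.sum_range_succ]
    exact (hQ.add_le _ _).trans (by gcongr)

lemma tsum_le_of_sum_le {G : ℕ → C(UnitSphere d, ℂ)} (hG : Summable G) {C : ℝ}
    (hC : ∀ n, ∑ j ∈ Finset.range n, Q (G j) ≤ C) : Q (∑' j, G j) ≤ C := by
  have ht := (hQ.continuous.tendsto _).comp hG.hasSum.tendsto_sum_nat
  exact le_of_tendsto' ht fun n => (hQ.sum_le G n).trans (hC n)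

/-- Two-sided control of the sum of a series with geometrically decaying terms away from two
consecutive dominant ones. -/
lemma tsum_comparable {G : ℕ → C(UnitSphere d, ℂ)} (hG : Summable G) (k : ℕ)
    (hup : ∀ j, k + 1 ≤ j → Q (G (j + 1)) ≤ 1 / 16 * Q (G j))
    (hdown : ∀ j, j < k → Q (G j) ≤ 1 / 16 * Q (G (j + 1)))
    (h1 : Q (G k) ≤ 2 * Q (G k + G (k + 1))) (h2 : Q (G (k + 1)) ≤ 2 * Q (G k + G (k + 1))) :
    max (Q (G k)) (Q (G (k + 1))) ≤ 3 * Q (∑' j, G j) ∧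
      Q (∑' j, G j) ≤ 3 * max (Q (G k)) (Q (G (k + 1))) := by
  set L := ∑ j ∈ Finset.range k, G j
  set T := ∑' j, G (j + (k + 2))
  have hF : ∑' j, G j = L + (G k + G (k + 1)) + T := by
    rw [← hG.sum_add_tsum_nat_add (k + 2), Finset.sum_range_succ, Finset.sum_range_succ, add_assoc L]
  -- Here `1 / 15` is the sum of `16 ^ (-j)` over `j ≥ 1`.
  have hL : Q L ≤ 1 / 15 * Q (G k) := by
    have aux : ∀ n ≤ k, ∑ j ∈ Finset.range n, Q (G j) ≤ 1 / 15 * Q (G n) := by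
      intro n
      induction n with
      | zero => intro _; simpa using hQ.nonneg (G 0)
      | succ n ih =>
        intro hn
        rw [Finset.sum_range_succ]
        have := ih (by omega)
        have := hdown n hn
        linarith
    exact (hQ.sum_le G k).trans (aux k le_rfl)
  have hT : Q T ≤ 1 / 15 * Q (G (k + 1)) := by
    refine hQ.tsum_le_of_sum_le ((summable_nat_add_iff (k + 2)).2 hG) fun n => ?_
    -- The extra term bounds the remaining tail and makes the induction close.
    suffices h : ∑ j ∈ Finset.range n, Q (G (j + (k + 2))) + 1 / 15 * Q (G (k + 1 + n)) ≤
        1 / 15 * Q (G (k + 1)) by linarith [hQ.nonneg (G (k + 1 + n))]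
    induction n with
    | zero => simp
    | succ n ih =>
      rw [Finset.sum_range_succ]
      have h := hup (k + 1 + n) (by omega)
      have e : n + (k + 2) = k + 1 + n + 1 := by omega
      rw [e, ← add_assoc (k + 1) n 1]
      linarith
  have hlow : Q (G k + G (k + 1)) ≤ Q (∑' j, G j) + Q L + Q T := by
    have e : G k + G (k + 1) = ∑' j, G j + -L + -T := by rw [hF]; abel
    calc Q (G k + G (k + 1)) = Q (∑' j, G j + -L + -T) := by rw [← e]
      _ ≤ Q (∑' j, G j + -L) + Q (-T) := hQ.add_le _ _
      _ ≤ Q (∑' j, G j) + Q (-L) + Q (-T) := by gcongr; exact hQ.add_le _ _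
      _ = _ := by rw [hQ.neg, hQ.neg]
  have hupp : Q (∑' j, G j) ≤ Q L + (Q (G k) + Q (G (k + 1))) + Q T := by
    rw [hF]
    refine (hQ.add_le _ _).trans ?_
    gcongr
    refine (hQ.add_le _ _).trans ?_
    gcongr
    exact hQ.add_le _ _
  have m1 := le_max_left (Q (G k)) (Q (G (k + 1)))
  have m2 := le_max_right (Q (G k)) (Q (G (k + 1)))
  have m3 : max (Q (G k)) (Q (G (k + 1))) ≤ 2 * Q (G k + G (k + 1)) := max_le h1 h2
  -- With `m` the maximum, `m ≤ 2 (Q F + 2 m / 15)` gives `m ≤ (30 / 11) Q F`, and `Q F ≤ (2 + 2 /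
  -- 15) m`.
  constructor <;> linarith

lemma coordPow_pos (n : ℕ) : 0 < Q (coordPow i n) := by
  obtain ⟨κ, hκ, h⟩ := hQ.coord_pow (1 / 2) (by norm_num) (by norm_num)
  exact lt_of_lt_of_le (by positivity) (h n _ (coordPow_apply i n))

/-- Normalizing the monomials does not decrease the radius of convergence. -/
lemma summable_normalized {v : ℝ → ℝ} {N : ℕ → ℕ} {a : ℕ → ℝ} (hN : StrictMono N)
    (ha : ∀ k, 0 < a k) (hav : ∀ k, ∀ r ∈ Ico (0 : ℝ) 1, a k * r ^ N k ≤ v r)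
    {R : ℝ} (hR : R ∈ Ico (0 : ℝ) 1) :
    Summable fun k => a k / Q (coordPow i (N k)) ^ (1 / q) * R ^ N k := by
  have hq := hQ.exponent_pos
  -- Two powers of `t` are spent: one on `a k * t ^ N k ≤ v t`, one on the lower bound for the mean
  -- of the monomial. Hence the need for `R < t ^ 2`.
  obtain ⟨t, ht1, ht2⟩ := exists_between (show √R < 1 by rw [Real.sqrt_lt' one_pos]; simpa using hR.2)
  have ht0 : 0 < t := (Real.sqrt_nonneg R).trans_lt ht1
  have hRt : R < t ^ 2 := (Real.sqrt_lt' ht0).1 ht1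
  obtain ⟨κ, hκ, hle⟩ := hQ.coord_pow (t ^ q) (by positivity) (Real.rpow_lt_one ht0.le ht2 hq)
  have hα : ∀ n, κ ^ (1 / q) * t ^ n ≤ Q (coordPow i n) ^ (1 / q) := fun n => by
    have h := Real.rpow_le_rpow (by positivity) (hle n _ (coordPow_apply i n))
      (one_div_pos.2 hq).le
    rw [Real.mul_rpow hκ.le (by positivity), ← Real.rpow_mul_natCast ht0.le, ← Real.rpow_mul ht0.le,
      mul_comm q, mul_assoc, mul_one_div_cancel hq.ne', mul_one, Real.rpow_natCast] at h
    exact h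
  have hratio : R / t ^ 2 < 1 := (div_lt_one (by positivity)).2 hRt
  have hratio0 : 0 ≤ R / t ^ 2 := div_nonneg hR.1 (by positivity)
  have hvt : 0 ≤ v t :=
    (mul_pos (ha 0) (pow_pos ht0 _)).le.trans (hav 0 t ⟨ht0.le, ht2⟩)
  refine Summable.of_nonneg_of_le (fun k => ?_) (fun k => ?_)
    ((summable_geometric_of_lt_one hratio0 hratio).mul_left (v t / κ ^ (1 / q)))
  · have := (ha k).le
    have := hR.1
    have := hQ.nonneg (coordPow i (N k))
    positivity
  · have hR0 := hR.1
    have := (ha k).le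
    calc a k / Q (coordPow i (N k)) ^ (1 / q) * R ^ N k
        ≤ a k / (κ ^ (1 / q) * t ^ N k) * R ^ N k := by
          gcongr
          exact hα _
      _ = a k * t ^ N k / κ ^ (1 / q) * (R / t ^ 2) ^ N k := by
          rw [div_pow, ← pow_mul, mul_comm 2, pow_mul]
          field_simp
      _ ≤ v t / κ ^ (1 / q) * (R / t ^ 2) ^ N k := by
          gcongr
          exact hav k t ⟨ht0.le, ht2⟩
      _ ≤ v t / κ ^ (1 / q) * (R / t ^ 2) ^ k := by
          refine mul_le_mul_of_nonneg_left ?_ (by positivity)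
          exact pow_le_pow_of_le_one hratio0 hratio.le (hN.id_le k)

end IsQuasiMean

/-- The power series `∑ A k (z i) ^ N k` in one coordinate. -/
noncomputable def coordSeries (i : Fin d) (N : ℕ → ℕ) (A : ℕ → ℝ)
    (z : EuclideanSpace ℂ (Fin d)) : ℂ :=
  ∑' k, (A k : ℂ) * z i ^ N k

lemma isHolomorphicOnBall_coordSeries (i : Fin d) {N : ℕ → ℕ} {A : ℕ → ℝ} (hA : ∀ k, 0 ≤ A k)
    (hsum : ∀ R ∈ Ico (0 : ℝ) 1, Summable fun k => A k * R ^ N k) :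
    IsHolomorphicOnBall d (coordSeries i N A) := by
  intro z hz
  have hzi : ‖z i‖ < 1 := (PiLp.norm_apply_le z i).trans_lt (mem_ball_zero_iff.1 hz)
  obtain ⟨R, hzR, hR⟩ := exists_between hzi
  have hR0 : 0 ≤ R := (norm_nonneg _).trans hzR.le
  have hd : DifferentiableOn ℂ (fun w : ℂ => ∑' k, (A k : ℂ) * w ^ N k) (ball 0 R) := by
    refine Complex.differentiableOn_tsum_of_summable_norm (hsum R ⟨hR0, hR⟩)
      (fun k => by fun_prop) isOpen_ball fun k w hw => ?_
    rw [norm_mul, Complex.norm_real, Real.norm_of_nonneg (hA k), norm_pow]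
    have := (mem_ball_zero_iff.1 hw).le
    have := hA k
    gcongr
  have hat : DifferentiableAt ℂ (fun w : ℂ => ∑' k, (A k : ℂ) * w ^ N k) (z i) :=
    hd.differentiableAt (isOpen_ball.mem_nhds (mem_ball_zero_iff.2 hzR))
  have hcoord : DifferentiableAt ℂ (fun z : EuclideanSpace ℂ (Fin d) => z i) z := by fun_prop
  exact (hat.comp z hcoord).differentiableWithinAt

lemma hasSum_slice_coordSeries (i : Fin d) {N : ℕ → ℕ} {A : ℕ → ℝ} (hA : ∀ k, 0 ≤ A k) {r : ℝ}
    (hr : 0 ≤ r) (hsum : Summable fun k => A k * r ^ N k) :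
    Summable (fun k => ((A k * r ^ N k : ℝ) : ℂ) • coordPow i (N k)) ∧
      ∀ ζ : UnitSphere d, (∑' k, ((A k * r ^ N k : ℝ) : ℂ) • coordPow i (N k)) ζ =
        coordSeries i N A (r • (ζ : EuclideanSpace ℂ (Fin d))) := by
  have hs : Summable (fun k => ((A k * r ^ N k : ℝ) : ℂ) • coordPow i (N k)) := by
    refine Summable.of_norm_bounded hsum fun k => ?_
    have := hA k
    rw [norm_smul, Complex.norm_real, Real.norm_of_nonneg (by positivity)]
    exact mul_le_of_le_one_right (by positivity) (norm_coordPow_le i _)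
  refine ⟨hs, fun ζ => ?_⟩
  rw [← ContinuousMap.tsum_apply hs, coordSeries]
  refine tsum_congr fun k => ?_
  rw [ContinuousMap.smul_apply, coordPow_apply, PiLp.smul_apply, Complex.real_smul, mul_pow,
    smul_eq_mul]
  push_cast
  ring

/-! ### Equivalence of functions and realization of log-convex weights -/

lemma EquivalentOn.symm {α : Type*} {X : Set α} {u v : α → ℝ} (h : EquivalentOn X u v) :
    EquivalentOn X v u := by
  obtain ⟨hpos, C₁, C₂, h1, h2, h⟩ := h
  refine ⟨fun x hx => (hpos x hx).symm, C₂⁻¹, C₁⁻¹, by positivity, by positivity, fun x hx => ?_⟩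
  rw [inv_mul_le_iff₀ h2, le_inv_mul_iff₀ h1]
  exact (h x hx).symm

lemma EquivalentOn.trans {α : Type*} {X : Set α} {u v w : α → ℝ} (h : EquivalentOn X u v)
    (h' : EquivalentOn X v w) : EquivalentOn X u w := by
  obtain ⟨hpos, C₁, C₂, h1, h2, h⟩ := h
  obtain ⟨hpos', D₁, D₂, k1, k2, h'⟩ := h'
  refine ⟨fun x hx => ⟨(hpos x hx).1, (hpos' x hx).2⟩, D₁ * C₁, D₂ * C₂, by positivity,
    by positivity, fun x hx => ⟨?_, ?_⟩⟩
  · rw [mul_assoc]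
    exact (mul_le_mul_of_nonneg_left (h x hx).1 k1.le).trans (h' x hx).1
  · rw [mul_assoc]
    exact (h' x hx).2.trans (mul_le_mul_of_nonneg_left (h x hx).2 k2.le)

lemma exists_equivalentOn_of_bounded (i : Fin d) {p : ℝ≥0∞} (hp : 0 < p) {v : ℝ → ℝ}
    (hv : IsWeight v) {C : ℝ} (hC : ∀ r ∈ Ico (0 : ℝ) 1, v r ≤ C) :
    ∃ f : EuclideanSpace ℂ (Fin d) → ℂ, IsHolomorphicOnBall d f ∧
      EquivalentOn (Ico (0 : ℝ) 1) (integralMean p f) v := by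
  obtain ⟨q, Q, hQ, h⟩ := exists_isQuasiMean i hp
  set M := Q (coordPow i 0) ^ (1 / q)
  have hM : 0 < M := Real.rpow_pos_of_pos (hQ.coordPow_pos 0) _
  have hv0 := hv.zero_pos
  have hC0 : 0 < C := hv0.trans_le (hC 0 ⟨le_rfl, one_pos⟩)
  have heq : ∀ r ∈ Ico (0 : ℝ) 1,
      integralMean p (fun _ : EuclideanSpace ℂ (Fin d) => 1) r = M := fun r hr =>
    h _ r _ hr.1 fun ζ => by rw [coordPow_apply, pow_zero]
  refine ⟨fun _ => 1, differentiableOn_const _, fun r hr => ?_, v 0 / M, C / M, by positivity,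
    by positivity, fun r hr => ?_⟩
  · rw [heq r hr]
    exact ⟨hM, hv.pos r hr⟩
  · rw [heq r hr, div_mul_cancel₀ _ hM.ne', div_mul_cancel₀ _ hM.ne']
    exact ⟨hv.zero_le hr, hC r hr⟩

/-- Dividing `a k` by the mean of its monomial gives the `k`-th term at radius `r` the mean `a k * r
^ N k` exactly, so the lacunary estimates for `v` apply to the series. -/
lemma exists_equivalentOn_of_unbounded (i : Fin d) {p : ℝ≥0∞} (hp : 0 < p) {v : ℝ → ℝ}
    (hv : IsLogConvexWeight v) (hunb : ∀ C, ∃ r ∈ Ico (0 : ℝ) 1, C < v r) :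
    ∃ f : EuclideanSpace ℂ (Fin d) → ℂ, IsHolomorphicOnBall d f ∧
      EquivalentOn (Ico (0 : ℝ) 1) (integralMean p f) v := by
  obtain ⟨q, Q, hQ, h⟩ := exists_isQuasiMean i hp
  have hq := hQ.exponent_pos
  have hq' : 0 < 1 / q := one_div_pos.2 hq
  have hroot : ∀ x : ℝ, 0 ≤ x → (x ^ (1 / q)) ^ q = x := fun x hx => by
    rw [← Real.rpow_mul hx, one_div_mul_cancel hq.ne', Real.rpow_one]
  have hroot' : ∀ x : ℝ, 0 ≤ x → (x ^ q) ^ (1 / q) = x := fun x hx => by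
    rw [← Real.rpow_mul hx, mul_one_div_cancel hq.ne', Real.rpow_one]
  -- `Q` scales as a `q`-th power, so this ratio becomes the `1 / 16` of `tsum_comparable`.
  set ε : ℝ := (1 / 16) ^ (1 / q)
  have hε : 0 < ε := by positivity
  have hε1 : ε ≤ 1 := Real.rpow_le_one (by norm_num) (by norm_num) hq'.le
  have hεq : ε ^ q = 1 / 16 := hroot _ (by norm_num)
  obtain ⟨N, a, K, hN, ha, hK, hav, hdom⟩ := hv.exists_lacunary hunb hε hε1
  set A : ℕ → ℝ := fun k => a k / Q (coordPow i (N k)) ^ (1 / q) with hA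
  have hαpos : ∀ k, 0 < Q (coordPow i (N k)) ^ (1 / q) := fun k =>
    Real.rpow_pos_of_pos (hQ.coordPow_pos _) _
  have hA0 : ∀ k, 0 ≤ A k := fun k => (div_pos (ha k) (hαpos k)).le
  have hsum : ∀ R ∈ Ico (0 : ℝ) 1, Summable fun k => A k * R ^ N k := fun R hR =>
    hQ.summable_normalized hN ha hav hR
  have main : ∀ r ∈ Ico (0 : ℝ) 1, ((1 / 3) ^ (1 / q) / K) * v r ≤
      integralMean p (coordSeries i N A) r ∧
      integralMean p (coordSeries i N A) r ≤ 3 ^ (1 / q) * v r := fun r hr => by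
    have hr0 : 0 ≤ r := hr.1
    have hvr := hv.pos r hr
    obtain ⟨hs, hval⟩ := hasSum_slice_coordSeries i hA0 hr0 (hsum r hr)
    set G : ℕ → C(UnitSphere d, ℂ) := fun k => ((A k * r ^ N k : ℝ) : ℂ) • coordPow i (N k)
    rw [h _ r _ hr0 hval]
    have hu0 : ∀ k, 0 ≤ a k * r ^ N k := fun k => mul_nonneg (ha k).le (pow_nonneg hr0 _)
    have hQG : ∀ k, Q (G k) = (a k * r ^ N k) ^ q := fun k => by
      have h0 := hA0 k
      rw [hQ.smul, Complex.norm_real, Real.norm_of_nonneg (by positivity)]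
      conv_lhs => rw [← hroot _ (hQ.nonneg (coordPow i (N k)))]
      rw [← Real.mul_rpow (by positivity) (hαpos k).le]
      congr 1
      simp only [hA]
      rw [div_mul_eq_mul_div, div_mul_cancel₀ _ (hαpos k).ne']
    obtain ⟨k, hup, hdown, hmax⟩ := hdom r hr
    have htwo := hQ.le_two_mul_add (hN k.lt_succ_self) ((A k * r ^ N k : ℝ) : ℂ)
      ((A (k + 1) * r ^ N (k + 1) : ℝ) : ℂ)
    have hmulq : ∀ x y : ℝ, 0 ≤ x → 0 ≤ y → x ≤ ε * y → x ^ q ≤ 1 / 16 * y ^ q :=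
      fun x y hx hy hxy => by
        rw [← hεq, ← Real.mul_rpow hε.le hy]
        exact Real.rpow_le_rpow hx hxy hq.le
    obtain ⟨hlo, hhi⟩ := hQ.tsum_comparable hs k
      (fun j hj => by rw [hQG, hQG]; exact hmulq _ _ (hu0 _) (hu0 _) (hup j hj))
      (fun j hj => by rw [hQG, hQG]; exact hmulq _ _ (hu0 _) (hu0 _) (hdown j hj)) htwo.1 htwo.2
    set m := max (a k * r ^ N k) (a (k + 1) * r ^ N (k + 1)) with hm
    have hm0 : 0 ≤ m := le_max_of_le_left (hu0 k)
    have hmq : max (Q (G k)) (Q (G (k + 1))) = m ^ q := by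
      rw [hQG, hQG]
      rcases le_total (a k * r ^ N k) (a (k + 1) * r ^ N (k + 1)) with h | h
      · rw [hm, max_eq_right h, max_eq_right (Real.rpow_le_rpow (hu0 _) h hq.le)]
      · rw [hm, max_eq_left h, max_eq_left (Real.rpow_le_rpow (hu0 _) h hq.le)]
    have hmv : m ≤ v r := max_le (hav k r hr) (hav (k + 1) r hr)
    rw [hmq] at hlo hhi
    have hF0 := hQ.nonneg (∑' j, G j)
    constructor
    · have h1 : 1 / 3 * m ^ q ≤ Q (∑' j, G j) := by linarith
      have h2 := Real.rpow_le_rpow (by positivity) h1 hq'.le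
      rw [Real.mul_rpow (by norm_num) (by positivity), hroot' m hm0] at h2
      refine le_trans ?_ h2
      calc (1 / 3) ^ (1 / q) / K * v r ≤ (1 / 3) ^ (1 / q) / K * (K * m) := by gcongr
        _ = _ := by field_simp
    · have h2 := Real.rpow_le_rpow hF0 hhi hq'.le
      rw [Real.mul_rpow (by norm_num) (by positivity), hroot' m hm0] at h2
      exact h2.trans (by gcongr)
  refine ⟨coordSeries i N A, isHolomorphicOnBall_coordSeries i hA0 hsum, EquivalentOn.symm
    ⟨fun r hr => ⟨hv.pos r hr, lt_of_lt_of_le ?_ (main r hr).1⟩, _, _, ?_, ?_, main⟩⟩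
  · have := hv.pos r hr
    positivity
  · positivity
  · positivity

end Lacunary

theorem corollary2p2 (d : ℕ) (hd : 1 ≤ d) (p : ℝ≥0∞) (hp : 0 < p)
    (w : ℝ → ℝ) (hw : IsWeight w) :
    (∃ v : ℝ → ℝ, IsLogConvexWeight v ∧ EquivalentOn (Ico (0 : ℝ) 1) w v) ↔
      ∃ f : EuclideanSpace ℂ (Fin d) → ℂ, IsHolomorphicOnBall d f ∧
        EquivalentOn (Ico (0 : ℝ) 1) (integralMean p f) w := by
  let i : Fin d := ⟨0, hd⟩
  constructor
  · rintro ⟨v, hv, hwv⟩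
    have key : ∃ f : EuclideanSpace ℂ (Fin d) → ℂ, IsHolomorphicOnBall d f ∧
        EquivalentOn (Ico (0 : ℝ) 1) (integralMean p f) v := by
      -- The greedy selection never stops only when `v` is unbounded.
      by_cases h : ∃ C, ∀ r ∈ Ico (0 : ℝ) 1, v r ≤ C
      · obtain ⟨C, hC⟩ := h
        exact exists_equivalentOn_of_bounded i hp hv.toIsWeight hC
      · push Not at h
        exact exists_equivalentOn_of_unbounded i hp hv h
    obtain ⟨f, hf, hfv⟩ := key
    exact ⟨f, hf, hfv.trans hwv.symm⟩
  · rintro ⟨f, hf, hfw⟩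
    exact ⟨integralMean p f, isLogConvexWeight_integralMean i hp hf fun r hr => (hfw.1 r hr).1,
      hfw.symm⟩
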